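/- Let $\lambda>0$, $c>0$, $0<p<1$, and let $d_j=(\cos(\pi j/2),\sin(\pi j/2))$, with $j$ taken modulo $4$. A particle starts from the origin of $\mathbb R^2$ at time $0$ and moves with constant speed $c$; its initial direction is uniformly distributed on $\{d_0,d_1,d_2,d_3\}$, and its direction changes exactly at the events of a homogeneous Poisson process of intensity $\lambda$. At each event, if the particle is moving horizontally (along $d_0$ or $d_2$) it turns counterclockwise (from $d_j$ to $d_{j+1}$) with probability $p$ and clockwise (from $d_j$ to $d_{j-1}$) with probability $1-p$; if it is moving vertically (along $d_1$ or $d_3$) it turns counterclockwise with probability $1-p$ and clockwise with probability $p$. The sequence of successive directions is a Markov chain independent of the Poisson process. Let $(X(t),Y(t))$ be the position of the particle at time $t$, and let $I_0(z)=\sum_{k\ge 0}\frac{(z/2)^{2k}}{(k!)^2}$ be the modified Bessel function of order zero. Then, for every $t>0$, the law of $(X(t),Y(t))$ restricted to the open square $\{(x,y):|x|+|y|<ct\}$ is absolutely continuous with respect to the Lebesgue measure, with density, for $|x|+|y|<ct$, $$f(x,y,t)=\frac{e^{-\lambda t}}{2c^2}\left[\lambda(1-p)\,I_0\!\left(\tfrac{\lambda(1-p)}{c}\sqrt{c^2t^2-(x+y)^2}\right)+\frac{\partial}{\partial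 t}I_0\!\left(\tfrac{\lambda(1-p)}{c}\sqrt{c^2t^2-(x+y)^2}\right)\right]$$ $$\qquad\cdot\left[\lambda p\,I_0\!\left(\tfrac{\lambda p}{c}\sqrt{c^2t^2-(x-y)^2}\right)+\frac{\partial}{\partial t}I_0\!\left(\tfrac{\lambda p}{c}\sqrt{c^2t^2-(x-y)^2}\right)\right].$$ In particular, the derivatives with respect to $t$ in this formula exist. That is, $f(\cdot,\cdot,t)$ is integrable on the open square, and $\mathbb P\big((X(t),Y(t))\in A\big)=\iint_A f(x,y,t)\,dx\,dy$ for every Borel subset $A$ of the open square. -/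

import Mathlib

open MeasureTheory ProbabilityTheory
open scoped NNReal

namespace PlanarMotion

/-- The modified Bessel function of the first kind of order zero,
`I₀(z) = ∑ₖ (z / 2) ^ (2 k) / (k!) ^ 2`. -/
noncomputable def besselI0 (z : ℝ) : ℝ :=
  ∑' k : ℕ, (z / 2) ^ (2 * k) / (k.factorial : ℝ) ^ 2

/-- The series defining `I₀` converges for every real argument. -/
theorem summable_besselI0 (z : ℝ) :
    Summable fun k : ℕ => (z / 2) ^ (2 * k) / (k.factorial : ℝ) ^ 2 := by
  refine Summable.of_nonneg_of_le (fun k => ?_) (fun k => ?_)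
    (Real.summable_pow_div_factorial ((z / 2) ^ 2))
  · rw [pow_mul]; positivity
  · rw [pow_mul]
    have h1 : (1 : ℝ) ≤ (k.factorial : ℝ) := by exact_mod_cast k.factorial_pos
    refine div_le_div_of_nonneg_left (by positivity) (by positivity) ?_
    nlinarith

variable {Ω : Type*} [MeasurableSpace Ω]

/-- `N` is a homogeneous Poisson process with intensity `lam` on `(Ω, P)`: it starts from `0`, has
independent Poisson distributed increments and, almost surely, nondecreasing right-continuous
paths. (Along nondecreasing paths the subtraction of natural numbers is the true one.) -/
structure IsPoissonProcess (N : ℝ≥0 → Ω → ℕ) (lam : ℝ) (P : Measure Ω) : Prop where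
  measurable : ∀ t, Measurable (N t)
  zero : ∀ᵐ ω ∂P, N 0 ω = 0
  monotone : ∀ᵐ ω ∂P, Monotone fun t => N t ω
  rightContinuous : ∀ᵐ ω ∂P, ∀ t, ContinuousWithinAt (fun s => N s ω) (Set.Ici t) t
  indepIncrements : HasIndepIncrements N P
  law_increment : ∀ s t : ℝ≥0, s ≤ t →
    HasLaw (fun ω => N t ω - N s ω) (poissonMeasure (lam.toNNReal * (t - s))) P

/-- The probability that, at a switch, a particle moving along `d_i` turns to `d_j`. Indices are
taken modulo `4`; `d_0`, `d_2` are horizontal and `d_1`, `d_3` are vertical. A particle moving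
horizontally turns counterclockwise with probability `p` and clockwise with probability `1 - p`; a
particle moving vertically turns counterclockwise with probability `1 - p` and clockwise with
probability `p`. -/
def turnProb (p : ℝ) (i j : Fin 4) : ℝ :=
  if j = i + 1 then (if i = 0 ∨ i = 2 then p else 1 - p)
  else if j = i - 1 then (if i = 0 ∨ i = 2 then 1 - p else p)
  else 0

/-- `ξ n` is (the index of) the direction taken after `n` switches: the initial direction is
uniform on the four directions and the successive turns follow the rule `turnProb p`, each
depending on the past only through the current direction. -/
structure IsDirectionChain (ξ : ℕ → Ω → Fin 4) (p : ℝ) (P : Measure Ω) : Prop where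
  measurable : ∀ n, Measurable (ξ n)
  law_path : ∀ (n : ℕ) (a : ℕ → Fin 4),
    P.real {ω | ∀ k ≤ n, ξ k ω = a k} =
      1 / 4 * ∏ k ∈ Finset.range n, turnProb p (a k) (a (k + 1))

/-- The random mechanism of the motion: switches occur at the events of a Poisson process `N` of
intensity `lam`, and the successive directions `ξ` follow the turning rule, independently of the
switching times. -/
structure IsDirectionMechanism (N : ℝ≥0 → Ω → ℕ) (ξ : ℕ → Ω → Fin 4) (lam p : ℝ)
    (P : Measure Ω) : Prop where
  poisson : IsPoissonProcess N lam P
  chain : IsDirectionChain ξ p P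
  indep : IndepFun (fun ω (t : ℝ≥0) => N t ω) (fun ω (n : ℕ) => ξ n ω) P

/-- The index of the direction `D(t)` at time `t`. -/
def direction (N : ℝ≥0 → Ω → ℕ) (ξ : ℕ → Ω → Fin 4) (t : ℝ≥0) (ω : Ω) : Fin 4 :=
  ξ (N t ω) ω

/-- The unit vector `d_j = (cos (π j / 2), sin (π j / 2))`. -/
noncomputable def dirVec (j : Fin 4) : ℝ × ℝ :=
  (Real.cos (Real.pi * (j : ℕ) / 2), Real.sin (Real.pi * (j : ℕ) / 2))

/-- The position `(X(t), Y(t))` at time `t ≥ 0` of the particle that starts from the origin and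
moves with velocity `c d_{D(s)}` at each time `s`. -/
noncomputable def position (N : ℝ≥0 → Ω → ℕ) (ξ : ℕ → Ω → Fin 4) (c t : ℝ) (ω : Ω) : ℝ × ℝ :=
  (∫ s in (0 : ℝ)..t, c * (dirVec (direction N ξ s.toNNReal ω)).1,
   ∫ s in (0 : ℝ)..t, c * (dirVec (direction N ξ s.toNNReal ω)).2)

/-- The open square `|x| + |y| < c t`. -/
def openSquare (c t : ℝ) : Set (ℝ × ℝ) := {z | |z.1| + |z.2| < c * t}

/-- The explicit density of the position in the interior of the square. -/
noncomputable def interiorDensity (lam p c x y t : ℝ) : ℝ :=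
  Real.exp (-(lam * t)) / (2 * c ^ 2) *
    (lam * (1 - p) *
        besselI0 (lam * (1 - p) / c * Real.sqrt (c ^ 2 * t ^ 2 - (x + y) ^ 2)) +
      deriv (fun s : ℝ =>
        besselI0 (lam * (1 - p) / c * Real.sqrt (c ^ 2 * s ^ 2 - (x + y) ^ 2))) t) *
    (lam * p *
        besselI0 (lam * p / c * Real.sqrt (c ^ 2 * t ^ 2 - (x - y) ^ 2)) +
      deriv (fun s : ℝ =>
        besselI0 (lam * p / c * Real.sqrt (c ^ 2 * s ^ 2 - (x - y) ^ 2))) t)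

end PlanarMotion

/-! In the coordinates `u = x + y`, `v = x - y` every direction has velocity `(± c, ± c)`, and each
turn reverses exactly one of the two signs. The turning rule is arranged so that, whatever the
current direction, `u` is reversed with probability `1 - p` and `v` with probability `p`. Thinning
the Poisson process therefore makes `u` and `v` independent symmetric telegraph processes with rates
`λ (1 - p)` and `λ p`. Each telegraph law has two atoms at `± c t` and a Bessel density between
them. The open square corresponds to the product of the open intervals and so avoids the atoms;
there the density is the product of the two densities times the Jacobian `2`.

Independence is proved through characteristic functions rather than by thinning. The position is a
limit of left Riemann sums. By the Markov property and the independence of the increments, the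
characteristic function of a Riemann sum with `m` steps is the average over initial directions of
the `m`-th iterate of `stepOp` applied to `1` (`integral_phaseProd`). `stepOp` is a contraction that
agrees with the generator up to order `h ^ 2`, so the iterates converge to the solution of the
backward equation (`tendsto_iterate_of_generator`). That solution is a product of two telegraph
characteristic functions (`hasDerivAt_motionChar`), and averaging over the four sign pairs
factorises it (`sum_motionChar`).

It remains to recognise the telegraph law from its transform (`charFun_telegraphLaw`). The Bessel
series is integrated term by term against the cosine; the moments are beta integrals, and the
binomial theorem sums the double series to `cosh` and `sinh` of `√(μ² - α² c²) t`. These are kept as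
power series in the radicand, so that its sign plays no role. -/

namespace PlanarMotion

/-! ### Exponential generating functions -/

/-- The exponential generating function `∑ aₙ tⁿ / n!`. -/
noncomputable def egf (a : ℕ → ℝ) (t : ℝ) : ℝ := ∑' n, a n * t ^ n / (n.factorial : ℝ)

theorem summable_egf_norm {a : ℕ → ℝ} {B : ℝ} (ha : ∀ n, |a n| ≤ B ^ n) (t : ℝ) :
    Summable fun n => ‖a n * t ^ n / (n.factorial : ℝ)‖ := by
  refine Summable.of_nonneg_of_le (fun n => norm_nonneg _) (fun n => ?_)
    (Real.summable_pow_div_factorial (B * |t|))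
  rw [norm_div, norm_mul, norm_pow, Real.norm_eq_abs, Real.norm_eq_abs, mul_pow,
    RCLike.norm_natCast]
  gcongr
  exact ha n

theorem hasSum_egf {a : ℕ → ℝ} {B : ℝ} (ha : ∀ n, |a n| ≤ B ^ n) (t : ℝ) :
    HasSum (fun n => a n * t ^ n / (n.factorial : ℝ)) (egf a t) :=
  (summable_egf_norm ha t).of_norm.hasSum

/-- Differentiation shifts the coefficients. The geometric bound gives a summable majorant of the
differentiated terms on the ball of radius `|t| + 1`, which justifies differentiating term by term.
-/
theorem hasDerivAt_egf {a : ℕ → ℝ} {B : ℝ} (ha : ∀ n, |a n| ≤ B ^ n) (t : ℝ) :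
    HasDerivAt (egf a) (egf (fun n => a (n + 1)) t) t := by
  have hB : 0 ≤ B := by simpa using (abs_nonneg _).trans (ha 1)
  have key : ∀ (n : ℕ) (s : ℝ), a (n + 1) * (((n + 1 : ℕ) : ℝ) * s ^ n) / ((n + 1).factorial : ℝ) =
      a (n + 1) * s ^ n / (n.factorial : ℝ) := by
    intro n s
    rw [Nat.factorial_succ]; push_cast
    have : (n.factorial : ℝ) ≠ 0 := by positivity
    field_simp
  have h := hasDerivAt_tsum_of_isPreconnected
    (u := fun n : ℕ => ‖(n : ℝ) * (B ^ n * (|t| + 1) ^ (n - 1)) / (n.factorial : ℝ)‖)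
    (g := fun (n : ℕ) s => a n * s ^ n / (n.factorial : ℝ))
    (g' := fun (n : ℕ) s => a n * (n * s ^ (n - 1)) / (n.factorial : ℝ))
    (t := Metric.ball (0 : ℝ) (|t| + 1)) (y₀ := t) (y := t) ?_ Metric.isOpen_ball
    (convex_ball _ _).isPreconnected ?_ ?_ (by simp) (summable_egf_norm ha t).of_norm (by simp)
  · refine h.congr_deriv ?_
    have hs : Summable fun n : ℕ => a n * (n * t ^ (n - 1)) / (n.factorial : ℝ) := by
      rw [← summable_nat_add_iff 1]
      have h1 : ∀ n, |a (n + 1)| ≤ B * B ^ n := fun n => by rw [← pow_succ']; exact ha _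
      refine Summable.of_norm_bounded ((Real.summable_pow_div_factorial (B * |t|)).mul_left B)
        fun n => ?_
      simp only [Nat.add_sub_cancel, key]
      rw [norm_div, norm_mul, norm_pow, Real.norm_eq_abs, Real.norm_eq_abs, mul_pow,
        RCLike.norm_natCast, ← mul_div_assoc, ← mul_assoc]
      gcongr
      exact h1 n
    rw [hs.tsum_eq_zero_add]
    simp only [egf, Nat.add_sub_cancel, key]
    simp
  · refine Summable.norm ?_
    rw [← summable_nat_add_iff 1]
    refine ((Real.summable_pow_div_factorial (B * (|t| + 1))).mul_left B).congr fun n => ?_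
    rw [Nat.factorial_succ]; push_cast
    have : (n.factorial : ℝ) ≠ 0 := by positivity
    simp only [mul_pow]
    field_simp
    ring
  · intro n s _
    exact ((hasDerivAt_pow n s).const_mul _).div_const _
  · intro n s hs
    have hs' : |s| ≤ |t| + 1 := by
      have : |s| < |t| + 1 := by simpa using hs
      exact this.le
    simp only [norm_div, norm_mul, norm_pow, Real.norm_eq_abs, RCLike.norm_natCast]
    rw [abs_of_nonneg hB, abs_of_nonneg (by positivity : 0 ≤ |t| + 1)]
    calc |a n| * (n * |s| ^ (n - 1)) / (n.factorial : ℝ)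
        ≤ B ^ n * (n * (|t| + 1) ^ (n - 1)) / (n.factorial : ℝ) := by
          gcongr
          exact ha n
      _ = _ := by ring

/-! ### Moments and term-by-term cosine transforms -/

/-- The moments `∫ u^{2j} (a² - u²)^k` over `[-a, a]`. -/
theorem integral_even_pow_mul_sub_sq_pow (a : ℝ) (k : ℕ) : ∀ j : ℕ,
    ∫ u in (-a)..a, u ^ (2 * j) * (a ^ 2 - u ^ 2) ^ k =
      2 * 4 ^ k * k.factorial * (j + k).factorial * (2 * j).factorial /
        (j.factorial * (2 * (j + k) + 1).factorial) * a ^ (2 * (j + k) + 1) := by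
  induction k with
  | zero =>
    intro j
    have h : (-a) ^ (2 * j + 1) = -a ^ (2 * j + 1) := (by exact ⟨j, rfl⟩ : Odd _).neg_pow a
    simp only [pow_zero, mul_one, integral_pow, h, Nat.add_zero, Nat.factorial_zero,
      Nat.factorial_succ (2 * j)]
    push_cast
    have h1 : (j.factorial : ℝ) ≠ 0 := by positivity
    have h2 : ((2 * j).factorial : ℝ) ≠ 0 := by positivity
    field_simp
    ring
  | succ k ih =>
    intro j
    -- The boundary terms vanish because `a² - u²` does at `± a`; the integration by parts trades
    -- one factor `a² - u²` for `u²`, that is `(j, k + 1)` for `(j + 1, k)`.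
    have hparts := intervalIntegral.integral_mul_deriv_eq_deriv_mul (a := -a) (b := a)
      (u := fun u => (a ^ 2 - u ^ 2) ^ (k + 1))
      (u' := fun u => ((k + 1 : ℕ) : ℝ) * (a ^ 2 - u ^ 2) ^ k * (-(2 * u)))
      (v := fun u => u ^ (2 * j + 1) / (2 * j + 1)) (v' := fun u => u ^ (2 * j))
      (fun x _ => by
        have := (((hasDerivAt_pow 2 x).const_sub (a ^ 2)).pow (k + 1))
        exact this.congr_deriv (by simp))
      (fun x _ => by
        have := (hasDerivAt_pow (2 * j + 1) x).div_const (2 * (j : ℝ) + 1)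
        refine this.congr_deriv ?_
        have : (2 * (j : ℝ) + 1) ≠ 0 := by positivity
        push_cast
        field_simp)
      (Continuous.intervalIntegrable (by fun_prop) _ _)
      (Continuous.intervalIntegrable (by fun_prop) _ _)
    have e1 : ∫ u in (-a)..a, u ^ (2 * j) * (a ^ 2 - u ^ 2) ^ (k + 1) =
        ∫ u in (-a)..a, (a ^ 2 - u ^ 2) ^ (k + 1) * u ^ (2 * j) := by
      congr 1; ext u; ring
    have e2 : ∫ u in (-a)..a, ((k + 1 : ℕ) : ℝ) * (a ^ 2 - u ^ 2) ^ k * (-(2 * u)) *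
          (u ^ (2 * j + 1) / (2 * j + 1)) =
        -(2 * (k + 1) / (2 * j + 1)) * ∫ u in (-a)..a, u ^ (2 * (j + 1)) * (a ^ 2 - u ^ 2) ^ k := by
      rw [← intervalIntegral.integral_const_mul]
      congr 1; ext u; push_cast; ring
    rw [e1, hparts, e2, ih (j + 1)]
    have e3 : j + 1 + k = j + (k + 1) := by ring
    have e4 : 2 * (j + 1) = (2 * j + 1) + 1 := by ring
    rw [e3, e4, Nat.factorial_succ (2 * j + 1), Nat.factorial_succ (2 * j), Nat.factorial_succ j,
      Nat.factorial_succ k]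
    push_cast
    have h1 : (j.factorial : ℝ) ≠ 0 := by positivity
    have h2 : ((2 * (j + (k + 1)) + 1).factorial : ℝ) ≠ 0 := by positivity
    field_simp
    simp
    ring

/-- Integration term by term of `cos (α u) ∑ βₖ (a² - u²)ᵏ`. -/
theorem hasSum_integral_cos_mul {a : ℝ} (ha : 0 ≤ a) (α : ℝ) {β : ℕ → ℝ}
    (hβ : Summable fun k => |β k| * (a ^ 2) ^ k) :
    HasSum (fun n => ∑ x ∈ Finset.HasAntidiagonal.antidiagonal n,
        (-1) ^ x.1 * α ^ (2 * x.1) / ((2 * x.1).factorial : ℝ) * β x.2 *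
          (2 * 4 ^ x.2 * x.2.factorial * n.factorial * (2 * x.1).factorial /
            (x.1.factorial * (2 * n + 1).factorial) * a ^ (2 * n + 1)))
      (∫ u in (-a)..a, Real.cos (α * u) * ∑' k, β k * (a ^ 2 - u ^ 2) ^ k) := by
  -- On the interval `|u| ≤ a` and `|a² - u²| ≤ a²`, so the double series is dominated by a `cosh`
  -- series times the assumed one.
  have hcos : Summable fun j : ℕ => |α * a| ^ (2 * j) / ((2 * j).factorial : ℝ) :=
    (Real.hasSum_cosh |α * a|).summable
  have hbound : Summable fun x : ℕ × ℕ =>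
      |α * a| ^ (2 * x.1) / ((2 * x.1).factorial : ℝ) * (|β x.2| * (a ^ 2) ^ x.2) :=
    hcos.mul_of_nonneg hβ (fun j => by positivity) (fun k => by positivity)
  have hu : ∀ u ∈ Set.uIoc (-a) a, |u| ≤ a ∧ |a ^ 2 - u ^ 2| ≤ a ^ 2 := by
    intro u hu
    rw [Set.uIoc_of_le (by linarith)] at hu
    have h1 : |u| ≤ a := abs_le.2 ⟨hu.1.le, hu.2⟩
    have h2 : u ^ 2 ≤ a ^ 2 := by rw [← sq_abs u]; gcongr
    exact ⟨h1, abs_le.2 ⟨by nlinarith [sq_nonneg a], by nlinarith [sq_nonneg u]⟩⟩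
  have hterm : ∀ u ∈ Set.uIoc (-a) a, ∀ x : ℕ × ℕ,
      ‖((-1) ^ x.1 * (α * u) ^ (2 * x.1) / ((2 * x.1).factorial : ℝ)) *
          (β x.2 * (a ^ 2 - u ^ 2) ^ x.2)‖ ≤
        |α * a| ^ (2 * x.1) / ((2 * x.1).factorial : ℝ) * (|β x.2| * (a ^ 2) ^ x.2) := by
    intro u hu' x
    obtain ⟨h1, h2⟩ := hu u hu'
    simp only [norm_mul, norm_div, norm_pow, Real.norm_eq_abs, abs_neg, abs_one, one_pow, one_mul,
      RCLike.norm_natCast]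
    rw [abs_mul α a, abs_of_nonneg ha]
    gcongr
  have hpairs : HasSum (fun x : ℕ × ℕ => ∫ u in (-a)..a,
      ((-1) ^ x.1 * (α * u) ^ (2 * x.1) / ((2 * x.1).factorial : ℝ)) *
        (β x.2 * (a ^ 2 - u ^ 2) ^ x.2))
      (∫ u in (-a)..a, Real.cos (α * u) * ∑' k, β k * (a ^ 2 - u ^ 2) ^ k) := by
    refine intervalIntegral.hasSum_integral_of_dominated_convergence
      (fun x _ => |α * a| ^ (2 * x.1) / ((2 * x.1).factorial : ℝ) * (|β x.2| * (a ^ 2) ^ x.2))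
      (fun x => (Continuous.aestronglyMeasurable (by fun_prop)))
      (fun x => Filter.Eventually.of_forall fun u hu' => hterm u hu' x)
      (Filter.Eventually.of_forall fun _ _ => hbound) (by simp)
      (Filter.Eventually.of_forall fun u hu' => ?_)
    have h1 : Summable fun k => β k * (a ^ 2 - u ^ 2) ^ k := by
      refine Summable.of_norm_bounded hβ fun k => ?_
      rw [norm_mul, norm_pow, Real.norm_eq_abs, Real.norm_eq_abs]
      gcongr
      exact (hu u hu').2
    exact (Real.hasSum_cos (α * u)).mul h1.hasSum (Summable.of_norm_bounded hbound (hterm u hu'))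
  have hvals : ∀ x : ℕ × ℕ, ∫ u in (-a)..a,
      ((-1) ^ x.1 * (α * u) ^ (2 * x.1) / ((2 * x.1).factorial : ℝ)) *
        (β x.2 * (a ^ 2 - u ^ 2) ^ x.2) =
      (-1) ^ x.1 * α ^ (2 * x.1) / ((2 * x.1).factorial : ℝ) * β x.2 *
        (2 * 4 ^ x.2 * x.2.factorial * (x.1 + x.2).factorial * (2 * x.1).factorial /
            (x.1.factorial * (2 * (x.1 + x.2) + 1).factorial) * a ^ (2 * (x.1 + x.2) + 1)) := by
    intro x
    rw [← integral_even_pow_mul_sub_sq_pow, ← intervalIntegral.integral_const_mul]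
    congr 1; ext u; rw [mul_pow]; ring
  simp only [hvals] at hpairs
  -- The `(j, k)` moment is a multiple of `a ^ (2 (j + k) + 1)`; grouping by `j + k` gives a power
  -- series in `a`.
  rw [← Finset.HasAntidiagonal.sigmaAntidiagonalEquivProd.hasSum_iff] at hpairs
  have := hpairs.sigma (g := fun n => ∑ x ∈ Finset.HasAntidiagonal.antidiagonal n,
        (-1) ^ x.1 * α ^ (2 * x.1) / ((2 * x.1).factorial : ℝ) * β x.2 *
          (2 * 4 ^ x.2 * x.2.factorial * n.factorial * (2 * x.1).factorial /
            (x.1.factorial * (2 * n + 1).factorial) * a ^ (2 * n + 1))) fun n => by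
    rw [← Finset.sum_coe_sort]
    convert hasSum_fintype _ using 3 with x hx
    have h := Finset.HasAntidiagonal.mem_antidiagonal.1 x.2
    simp [Finset.HasAntidiagonal.sigmaAntidiagonalEquivProd, h]
  exact this

/-! ### Hyperbolic functions of a square root -/

/-- `∑ κⁿ t²ⁿ / (2n)!`, that is, `cosh (√κ t)` for real `κ` of either sign. -/
noncomputable def coshSqrt (κ : ℝ) : ℝ → ℝ := egf fun n => if Even n then κ ^ (n / 2) else 0

/-- `∑ κⁿ t²ⁿ⁺¹ / (2n+1)!`, that is, `sinh (√κ t) / √κ` for real `κ` of either sign. -/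
noncomputable def sinhSqrt (κ : ℝ) : ℝ → ℝ := egf fun n => if Even n then 0 else κ ^ (n / 2)

theorem abs_pow_half_le (κ : ℝ) (n : ℕ) : |κ ^ (n / 2)| ≤ (1 + |κ|) ^ n := by
  rw [abs_pow]
  calc |κ| ^ (n / 2) ≤ (1 + |κ|) ^ (n / 2) := by gcongr; linarith
    _ ≤ (1 + |κ|) ^ n := pow_le_pow_right₀ (by linarith [abs_nonneg κ]) (Nat.div_le_self n 2)

theorem abs_coshSqrt_coeff_le (κ : ℝ) (n : ℕ) :
    |if Even n then κ ^ (n / 2) else 0| ≤ (1 + |κ|) ^ n := by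
  split_ifs
  · exact abs_pow_half_le κ n
  · rw [abs_zero]; positivity

theorem abs_sinhSqrt_coeff_le (κ : ℝ) (n : ℕ) :
    |if Even n then 0 else κ ^ (n / 2)| ≤ (1 + |κ|) ^ n := by
  split_ifs
  · rw [abs_zero]; positivity
  · exact abs_pow_half_le κ n

theorem hasSum_coshSqrt (κ t : ℝ) :
    HasSum (fun n => κ ^ n * t ^ (2 * n) / ((2 * n).factorial : ℝ)) (coshSqrt κ t) := by
  have h : HasSum _ (coshSqrt κ t) := hasSum_egf (abs_coshSqrt_coeff_le κ) t
  have hinj : Function.Injective fun n : ℕ => 2 * n := fun a b h => by simpa using h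
  rw [← hinj.hasSum_iff] at h
  · convert h using 2 with n
    simp
  · intro n hn
    have : ¬ Even n := fun ⟨m, hm⟩ => hn ⟨m, by simp only; omega⟩
    simp [this]

theorem hasSum_sinhSqrt (κ t : ℝ) :
    HasSum (fun n => κ ^ n * t ^ (2 * n + 1) / ((2 * n + 1).factorial : ℝ)) (sinhSqrt κ t) := by
  have h : HasSum _ (sinhSqrt κ t) := hasSum_egf (abs_sinhSqrt_coeff_le κ) t
  have hinj : Function.Injective fun n : ℕ => 2 * n + 1 := fun a b h => by simpa using h
  rw [← hinj.hasSum_iff] at h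
  · convert h using 2 with n
    have h1 : ¬ Even (2 * n + 1) := by simp
    have h2 : (2 * n + 1) / 2 = n := by omega
    simp only [Function.comp_apply, if_neg h1, h2]
  · intro n hn
    have : Even n := by
      by_contra h
      obtain ⟨m, hm⟩ := Nat.not_even_iff_odd.1 h
      exact hn ⟨m, hm.symm⟩
    simp [this]

theorem hasDerivAt_sinhSqrt (κ t : ℝ) : HasDerivAt (sinhSqrt κ) (coshSqrt κ t) t := by
  refine (hasDerivAt_egf (abs_sinhSqrt_coeff_le κ) t).congr_deriv ?_
  unfold coshSqrt
  congr 1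
  ext n
  rcases Nat.even_or_odd' n with ⟨m, rfl | rfl⟩
  · have h2 : (2 * m + 1) / 2 = m := by omega
    simp [h2]
  · simp [Nat.even_add_one]

theorem hasDerivAt_coshSqrt (κ t : ℝ) : HasDerivAt (coshSqrt κ) (κ * sinhSqrt κ t) t := by
  refine (hasDerivAt_egf (abs_coshSqrt_coeff_le κ) t).congr_deriv ?_
  unfold sinhSqrt egf
  rw [← tsum_mul_left]
  congr 1
  ext n
  rcases Nat.even_or_odd' n with ⟨m, rfl | rfl⟩
  · simp
  · have h2 : (2 * m + 1) / 2 = m := by omega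
    have h3 : (2 * m + 1 + 1) / 2 = m + 1 := by omega
    simp only [Nat.even_add_one, h2, h3]
    simp
    ring

theorem coshSqrt_zero (κ : ℝ) : coshSqrt κ 0 = 1 := by
  refine (hasSum_coshSqrt κ 0).unique ?_
  convert hasSum_single 0 ?_ using 1
  · simp
  · intro n hn; simp [hn]

theorem sinhSqrt_zero (κ : ℝ) : sinhSqrt κ 0 = 0 := by
  refine (hasSum_sinhSqrt κ 0).unique ?_
  simp [hasSum_zero]

/-! ### The Bessel series and its cosine transform -/

/-- `∑ zᵏ / (k!)²`, so that `I₀(z) = besselSeries (z² / 4)`. -/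
noncomputable def besselSeries : ℝ → ℝ := egf fun n => 1 / (n.factorial : ℝ)

/-- `∑ zᵏ / (k! (k+1)!)`, the derivative of `besselSeries`. -/
noncomputable def besselSeriesDeriv : ℝ → ℝ := egf fun n => 1 / ((n + 1).factorial : ℝ)

theorem abs_one_div_factorial_le (n : ℕ) : |1 / (n.factorial : ℝ)| ≤ 1 := by
  have h : (1 : ℝ) ≤ (n.factorial : ℝ) := by exact_mod_cast n.factorial_pos
  rw [abs_of_nonneg (by positivity)]
  exact (div_le_one (by positivity)).2 h

theorem hasDerivAt_besselSeries (z : ℝ) :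
    HasDerivAt besselSeries (besselSeriesDeriv z) z :=
  hasDerivAt_egf (B := 1) (fun n => by simpa using abs_one_div_factorial_le n) z

theorem continuous_besselSeries : Continuous besselSeries :=
  continuous_iff_continuousAt.2 fun z => (hasDerivAt_besselSeries z).continuousAt

theorem continuous_besselSeriesDeriv : Continuous besselSeriesDeriv :=
  continuous_iff_continuousAt.2 fun z =>
    (hasDerivAt_egf (B := 1) (fun n => by simpa using abs_one_div_factorial_le (n + 1))
      z).continuousAt

theorem besselI0_mul_sqrt (m : ℝ) {y : ℝ} (hy : 0 ≤ y) :
    besselI0 (m * Real.sqrt y) = besselSeries (m ^ 2 / 4 * y) := by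
  unfold besselI0 besselSeries egf
  congr 1
  ext k
  rw [pow_mul, div_pow, mul_pow, Real.sq_sqrt hy]
  have : (k.factorial : ℝ) ≠ 0 := by positivity
  field_simp
  norm_num

theorem besselSeries_nonneg {z : ℝ} (hz : 0 ≤ z) : 0 ≤ besselSeries z :=
  tsum_nonneg fun n => by positivity

theorem besselSeriesDeriv_nonneg {z : ℝ} (hz : 0 ≤ z) : 0 ≤ besselSeriesDeriv z :=
  tsum_nonneg fun n => by positivity

/-- `I₀` is even, so its composite with the square root is an entire function of the radicand.
Strict positivity persists for nearby times, where the truncated `Real.sqrt` is the true root. -/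
theorem hasDerivAt_besselI0_sqrt (m c w t : ℝ) (h : 0 < c ^ 2 * t ^ 2 - w ^ 2) :
    HasDerivAt (fun s => besselI0 (m * Real.sqrt (c ^ 2 * s ^ 2 - w ^ 2)))
      (besselSeriesDeriv (m ^ 2 / 4 * (c ^ 2 * t ^ 2 - w ^ 2)) *
        (m ^ 2 / 4 * (c ^ 2 * (2 * t)))) t := by
  have hin : HasDerivAt (fun s : ℝ => m ^ 2 / 4 * (c ^ 2 * s ^ 2 - w ^ 2))
      (m ^ 2 / 4 * (c ^ 2 * (2 * t))) t := by
    have := (((hasDerivAt_pow 2 t).const_mul (c ^ 2)).sub_const (w ^ 2)).const_mul (m ^ 2 / 4)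
    exact this.congr_deriv (by simp)
  refine ((hasDerivAt_besselSeries _).comp t hin).congr_of_eventuallyEq ?_
  have hev : ∀ᶠ s in nhds t, 0 < c ^ 2 * s ^ 2 - w ^ 2 :=
    (Continuous.tendsto (by fun_prop : Continuous fun s : ℝ => c ^ 2 * s ^ 2 - w ^ 2) t).eventually
      (lt_mem_nhds h)
  filter_upwards [hev] with s hs
  exact besselI0_mul_sqrt m hs.le

/-- The factorials of the moments turn the coefficients into binomial ones, and the sum is the
expansion of `(-α² + 4 q) ^ n`. -/
theorem sum_antidiagonal_besselSeries (α q a : ℝ) (n : ℕ) :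
    ∑ x ∈ Finset.HasAntidiagonal.antidiagonal n,
        (-1) ^ x.1 * α ^ (2 * x.1) / ((2 * x.1).factorial : ℝ) *
          (q ^ x.2 / ((x.2.factorial : ℝ) * x.2.factorial)) *
          (2 * 4 ^ x.2 * x.2.factorial * n.factorial * (2 * x.1).factorial /
            (x.1.factorial * (2 * n + 1).factorial) * a ^ (2 * n + 1)) =
      2 * (a ^ (2 * n + 1) * (4 * q - α ^ 2) ^ n / ((2 * n + 1).factorial : ℝ)) := by
  have h0 : 4 * q - α ^ 2 = -α ^ 2 + 4 * q := by ring
  rw [h0, (Commute.all (-α ^ 2) (4 * q)).add_pow', Finset.mul_sum, Finset.sum_div, Finset.mul_sum]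
  refine Finset.sum_congr rfl fun x hx => ?_
  obtain ⟨j, k⟩ := x
  obtain rfl : j + k = n := Finset.HasAntidiagonal.mem_antidiagonal.1 hx
  have hc : (((j + k).choose j : ℕ) : ℝ) * j.factorial * k.factorial = (j + k).factorial := by
    rw [Nat.choose_symm_add]
    exact_mod_cast Nat.add_choose_mul_factorial_mul_factorial j k
  rw [nsmul_eq_mul, ← hc, mul_pow, neg_pow (α ^ 2), pow_mul]
  have h1 : (j.factorial : ℝ) ≠ 0 := by positivity
  have h2 : (k.factorial : ℝ) ≠ 0 := by positivity
  have h3 : ((2 * j).factorial : ℝ) ≠ 0 := by positivity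
  have h4 : ((2 * (j + k) + 1).factorial : ℝ) ≠ 0 := by positivity
  field_simp

/-- The factor `2 q a` raises the power of `q` by one, so the binomial expansion of degree `n + 1`
appears without its `q ^ 0` term. That missing term is the cosine coefficient subtracted on the
right. -/
theorem sum_antidiagonal_besselSeriesDeriv (α q a : ℝ) (n : ℕ) :
    ∑ x ∈ Finset.HasAntidiagonal.antidiagonal n,
        (-1) ^ x.1 * α ^ (2 * x.1) / ((2 * x.1).factorial : ℝ) *
          (q ^ x.2 / ((x.2.factorial : ℝ) * (x.2 + 1).factorial)) *
          (2 * 4 ^ x.2 * x.2.factorial * n.factorial * (2 * x.1).factorial /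
            (x.1.factorial * (2 * n + 1).factorial) * a ^ (2 * n + 1)) * (2 * q * a) =
      2 * (a ^ (2 * (n + 1)) * (4 * q - α ^ 2) ^ (n + 1) / ((2 * (n + 1)).factorial : ℝ)) -
        2 * ((-1) ^ (n + 1) * (α * a) ^ (2 * (n + 1)) / ((2 * (n + 1)).factorial : ℝ)) := by
  have h0 : 4 * q - α ^ 2 = -α ^ 2 + 4 * q := by ring
  rw [h0, (Commute.all (-α ^ 2) (4 * q)).add_pow', Finset.Nat.sum_antidiagonal_succ']
  have e1 : 2 * ((-1) ^ (n + 1) * (α * a) ^ (2 * (n + 1)) / ((2 * (n + 1)).factorial : ℝ)) =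
      2 * (a ^ (2 * (n + 1)) * ((n + 1).choose (n + 1) • ((-α ^ 2) ^ (n + 1) * (4 * q) ^ 0)) /
        ((2 * (n + 1)).factorial : ℝ)) := by
    rw [Nat.choose_self, one_smul, neg_pow (α ^ 2), mul_pow, pow_mul α]
    ring
  rw [e1, mul_add, add_div, mul_add, add_sub_cancel_left,
    Finset.mul_sum, Finset.sum_div, Finset.mul_sum]
  refine Finset.sum_congr rfl fun x hx => ?_
  obtain ⟨j, k⟩ := x
  obtain rfl : j + k = n := Finset.HasAntidiagonal.mem_antidiagonal.1 hx
  have hc : (((j + k + 1).choose j : ℕ) : ℝ) * j.factorial * (k + 1).factorial =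
      (j + k + 1).factorial := by
    rw [add_assoc, Nat.choose_symm_add]
    exact_mod_cast Nat.add_choose_mul_factorial_mul_factorial j (k + 1)
  rw [Nat.factorial_succ (j + k)] at hc
  rw [nsmul_eq_mul, mul_pow, neg_pow (α ^ 2), pow_mul]
  have h1 : (j.factorial : ℝ) ≠ 0 := by positivity
  have h2 : (k.factorial : ℝ) ≠ 0 := by positivity
  have h3 : ((2 * j).factorial : ℝ) ≠ 0 := by positivity
  have h4 : ((2 * (j + k) + 1).factorial : ℝ) ≠ 0 := by positivity
  have h5 : ((k + 1).factorial : ℝ) ≠ 0 := by positivity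
  have h6 : ((j + k : ℕ) : ℝ) + 1 ≠ 0 := by positivity
  have hc' : ((j + k).factorial : ℝ) =
      ((j + k + 1).choose j : ℕ) * j.factorial * (k + 1).factorial / (((j + k : ℕ) : ℝ) + 1) := by
    rw [hc]; push_cast; field_simp
  have e2 : 2 * (j + k + 1) = (2 * (j + k) + 1) + 1 := by ring
  rw [hc', e2, Nat.factorial_succ (2 * (j + k) + 1)]
  push_cast at h6 ⊢
  field_simp
  ring

theorem integral_cos_mul_besselSeries {a : ℝ} (ha : 0 ≤ a) (α q : ℝ) :
    ∫ u in (-a)..a, Real.cos (α * u) * besselSeries (q * (a ^ 2 - u ^ 2)) =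
      2 * sinhSqrt (4 * q - α ^ 2) a := by
  have h := hasSum_integral_cos_mul ha α
    (β := fun k => q ^ k / ((k.factorial : ℝ) * k.factorial)) ?_
  · simp only [sum_antidiagonal_besselSeries] at h
    have h2 := (hasSum_sinhSqrt (4 * q - α ^ 2) a).mul_left 2
    have h3 := h.unique (by simpa only [mul_comm (a ^ _)] using h2)
    rw [← h3]
    congr 1
    ext u
    unfold besselSeries egf
    congr 2
    ext k
    rw [mul_pow, div_mul_eq_div_div]
    ring
  · refine ((summable_egf_norm (a := fun n => 1 / (n.factorial : ℝ)) (B := 1)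
      (fun n => by simpa using abs_one_div_factorial_le n) (q * a ^ 2))).congr fun k => ?_
    simp only [norm_div, norm_mul, norm_pow, Real.norm_eq_abs, abs_mul, abs_div, abs_pow, abs_one,
      Nat.abs_cast, sq_abs, mul_pow]
    field_simp

/-- Keeping the factor `2 q a` on the left avoids a division and covers `q = 0` and `a = 0`. -/
theorem integral_cos_mul_besselSeriesDeriv {a : ℝ} (ha : 0 ≤ a) (α q : ℝ) :
    (∫ u in (-a)..a, Real.cos (α * u) * besselSeriesDeriv (q * (a ^ 2 - u ^ 2))) * (2 * q * a) =
      2 * (coshSqrt (4 * q - α ^ 2) a - Real.cos (α * a)) := by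
  have h := (hasSum_integral_cos_mul ha α
    (β := fun k => q ^ k / ((k.factorial : ℝ) * (k + 1).factorial)) ?_).mul_right (2 * q * a)
  · simp only [Finset.sum_mul, sum_antidiagonal_besselSeriesDeriv] at h
    -- The sums over `n + 1` omit the constant terms of both series; these are equal to `1` and
    -- cancel in the difference.
    have h1 := ((hasSum_nat_add_iff' 1).2 (hasSum_coshSqrt (4 * q - α ^ 2) a)).mul_left 2
    have h2 := ((hasSum_nat_add_iff' 1).2 (Real.hasSum_cos (α * a))).mul_left 2
    have h3 := h.unique (by simpa only [mul_comm (a ^ _)] using h1.sub h2)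
    simp only [Finset.sum_range_one, Nat.mul_zero, pow_zero, Nat.factorial_zero, Nat.cast_one,
      mul_one, div_one] at h3
    have h4 : ∫ u in (-a)..a, Real.cos (α * u) * besselSeriesDeriv (q * (a ^ 2 - u ^ 2)) =
        ∫ u in (-a)..a, Real.cos (α * u) * ∑' k : ℕ, q ^ k / ((k.factorial : ℝ) *
          (k + 1).factorial) * (a ^ 2 - u ^ 2) ^ k := by
      congr 1
      ext u
      unfold besselSeriesDeriv egf
      congr 2
      ext k
      rw [mul_pow, div_mul_eq_div_div]
      ring
    rw [h4, h3]
    ring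
  · refine ((summable_egf_norm (a := fun n => 1 / ((n + 1).factorial : ℝ)) (B := 1)
      (fun n => by simpa using abs_one_div_factorial_le (n + 1)) (q * a ^ 2))).congr fun k => ?_
    simp only [norm_div, norm_mul, norm_pow, Real.norm_eq_abs, abs_mul, abs_div, abs_pow, abs_one,
      Nat.abs_cast, sq_abs, mul_pow]
    field_simp

/-! ### The telegraph law and its characteristic function -/

/-- The density of the absolutely continuous part of the telegraph law with switching rate `μ` and
speed `c`. -/
noncomputable def telegraphDensity (μ c t u : ℝ) : ℝ :=
  Real.exp (-(μ * t)) / (2 * c) *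
    (μ * besselSeries ((μ / c) ^ 2 / 4 * ((c * t) ^ 2 - u ^ 2)) +
      besselSeriesDeriv ((μ / c) ^ 2 / 4 * ((c * t) ^ 2 - u ^ 2)) *
        (2 * ((μ / c) ^ 2 / 4) * (c * t)) * c)

/-- The law at time `t` of a symmetric telegraph process with switching rate `μ` and speed `c`. -/
noncomputable def telegraphLaw (μ c t : ℝ) : Measure ℝ :=
  ENNReal.ofReal (Real.exp (-(μ * t)) / 2) • (Measure.dirac (c * t) + Measure.dirac (-(c * t))) +
    (volume.restrict (Set.Ioo (-(c * t)) (c * t))).withDensity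
      fun u => ENNReal.ofReal (telegraphDensity μ c t u)

theorem continuous_telegraphDensity (μ c t : ℝ) : Continuous (telegraphDensity μ c t) := by
  have h1 : Continuous fun u : ℝ => (μ / c) ^ 2 / 4 * ((c * t) ^ 2 - u ^ 2) := by fun_prop
  have h2 := continuous_besselSeries.comp h1
  have h3 := continuous_besselSeriesDeriv.comp h1
  exact continuous_const.mul ((continuous_const.mul h2).add
    ((h3.mul continuous_const).mul continuous_const))

theorem telegraphDensity_nonneg {μ c t u : ℝ} (hμ : 0 ≤ μ) (hc : 0 < c) (ht : 0 ≤ t)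
    (hu : |u| ≤ c * t) : 0 ≤ telegraphDensity μ c t u := by
  have h1 : 0 ≤ (c * t) ^ 2 - u ^ 2 := by
    rw [← sq_abs u, sub_nonneg]; gcongr
  have h2 := besselSeries_nonneg (by positivity : 0 ≤ (μ / c) ^ 2 / 4 * ((c * t) ^ 2 - u ^ 2))
  have h3 := besselSeriesDeriv_nonneg (by positivity : 0 ≤ (μ / c) ^ 2 / 4 * ((c * t) ^ 2 - u ^ 2))
  unfold telegraphDensity
  positivity

theorem integrableOn_telegraphDensity (μ c t : ℝ) :
    IntegrableOn (telegraphDensity μ c t) (Set.Ioo (-(c * t)) (c * t)) :=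
  ((continuous_telegraphDensity μ c t).integrableOn_Icc).mono_set Set.Ioo_subset_Icc_self

instance isFiniteMeasure_telegraphLaw (μ c t : ℝ) : IsFiniteMeasure (telegraphLaw μ c t) := by
  have := isFiniteMeasure_withDensity_ofReal (integrableOn_telegraphDensity μ c t).hasFiniteIntegral
  have h2 : IsFiniteMeasure (ENNReal.ofReal (Real.exp (-(μ * t)) / 2) •
      (Measure.dirac (c * t) + Measure.dirac (-(c * t)))) :=
    Measure.smul_finite _ ENNReal.ofReal_ne_top
  unfold telegraphLaw
  infer_instance

theorem coshSqrt_mul (κ c t : ℝ) : coshSqrt κ (c * t) = coshSqrt (κ * c ^ 2) t := by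
  refine (hasSum_coshSqrt κ (c * t)).unique ?_
  refine (hasSum_coshSqrt (κ * c ^ 2) t).congr_fun fun n => ?_
  rw [mul_pow, mul_pow, pow_mul c]; ring

theorem sinhSqrt_mul (κ c t : ℝ) : sinhSqrt κ (c * t) = c * sinhSqrt (κ * c ^ 2) t := by
  refine (hasSum_sinhSqrt κ (c * t)).unique ?_
  refine ((hasSum_sinhSqrt (κ * c ^ 2) t).mul_left c).congr_fun fun n => ?_
  rw [mul_pow, mul_pow]; ring

theorem integral_cos_mul_telegraphDensity {μ c t : ℝ} (hc : 0 < c) (ht : 0 ≤ t) (α : ℝ) :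
    ∫ u in (-(c * t))..(c * t), Real.cos (α * u) * telegraphDensity μ c t u =
      Real.exp (-(μ * t)) * (coshSqrt (μ ^ 2 - α ^ 2 * c ^ 2) t +
        μ * sinhSqrt (μ ^ 2 - α ^ 2 * c ^ 2) t - Real.cos (α * (c * t))) := by
  set q := (μ / c) ^ 2 / 4 with hq
  have hκ : (4 * q - α ^ 2) * c ^ 2 = μ ^ 2 - α ^ 2 * c ^ 2 := by
    rw [hq]; field_simp
  have h1 : Continuous fun u : ℝ => q * ((c * t) ^ 2 - u ^ 2) := by fun_prop
  have h2 : Continuous fun u : ℝ => besselSeries (q * ((c * t) ^ 2 - u ^ 2)) :=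
    continuous_besselSeries.comp h1
  have h3 : Continuous fun u : ℝ => besselSeriesDeriv (q * ((c * t) ^ 2 - u ^ 2)) :=
    continuous_besselSeriesDeriv.comp h1
  have hcos : Continuous fun u : ℝ => Real.cos (α * u) := by fun_prop
  have hca : 0 ≤ c * t := by positivity
  have i0 := integral_cos_mul_besselSeries hca α q
  have i1 := integral_cos_mul_besselSeriesDeriv hca α q
  have e : ∀ u : ℝ, Real.cos (α * u) * telegraphDensity μ c t u =
      Real.exp (-(μ * t)) / (2 * c) * μ *
        (Real.cos (α * u) * besselSeries (q * ((c * t) ^ 2 - u ^ 2))) +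
      Real.exp (-(μ * t)) / (2 * c) * (2 * q * (c * t)) * c *
        (Real.cos (α * u) * besselSeriesDeriv (q * ((c * t) ^ 2 - u ^ 2))) := by
    intro u; unfold telegraphDensity; ring
  simp only [e]
  rw [intervalIntegral.integral_add
      (Continuous.intervalIntegrable (by fun_prop) _ _)
      (Continuous.intervalIntegrable (by fun_prop) _ _),
    intervalIntegral.integral_const_mul, intervalIntegral.integral_const_mul, i0]
  -- The integral enters only through its product with `2 q c t`, which may vanish, so the identity
  -- is used without solving for the integral.
  have i1' : ∀ X : ℝ, X * (2 * q * (c * t)) = 2 * (coshSqrt (4 * q - α ^ 2) (c * t) -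
      Real.cos (α * (c * t))) → Real.exp (-(μ * t)) / (2 * c) * (2 * q * (c * t)) * c * X =
      Real.exp (-(μ * t)) * (coshSqrt (4 * q - α ^ 2) (c * t) - Real.cos (α * (c * t))) := by
    intro X hX
    have : Real.exp (-(μ * t)) / (2 * c) * (2 * q * (c * t)) * c * X =
      Real.exp (-(μ * t)) / (2 * c) * c * (X * (2 * q * (c * t))) := by ring
    rw [this, hX]; field_simp
  rw [i1' _ i1, coshSqrt_mul, sinhSqrt_mul, hκ]
  field_simp
  ring

theorem integral_sin_mul_telegraphDensity (μ c t α : ℝ) :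
    ∫ u in (-(c * t))..(c * t), Real.sin (α * u) * telegraphDensity μ c t u = 0 := by
  have h := intervalIntegral.integral_comp_neg (a := -(c * t)) (b := c * t)
    (fun u => Real.sin (α * u) * telegraphDensity μ c t u)
  have e : ∀ u : ℝ, Real.sin (α * -u) * telegraphDensity μ c t (-u) =
      -(Real.sin (α * u) * telegraphDensity μ c t u) := by
    intro u
    unfold telegraphDensity
    rw [mul_neg, Real.sin_neg, neg_sq, neg_mul]
  simp only [e, neg_neg, intervalIntegral.integral_neg] at h
  linarith

/-- The two atoms contribute `exp (-μ t) cos (α c t)`, which cancels the cosine left over by the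
density; the sine part vanishes by symmetry. -/
theorem charFun_telegraphLaw {μ c t : ℝ} (hμ : 0 ≤ μ) (hc : 0 < c) (ht : 0 ≤ t) (α : ℝ) :
    charFun (telegraphLaw μ c t) α =
      ((Real.exp (-(μ * t)) * (coshSqrt (μ ^ 2 - α ^ 2 * c ^ 2) t +
        μ * sinhSqrt (μ ^ 2 - α ^ 2 * c ^ 2) t) : ℝ) : ℂ) := by
  have hexp : ∀ u : ℝ, Complex.exp (α * u * Complex.I) =
      (Real.cos (α * u) : ℂ) + (Real.sin (α * u) : ℂ) * Complex.I := by
    intro u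
    rw [← Complex.ofReal_mul, Complex.exp_mul_I, Complex.ofReal_cos, Complex.ofReal_sin]
  have hca : 0 ≤ c * t := by positivity
  have hint : ∀ ν : Measure ℝ, IsFiniteMeasure ν →
      Integrable (fun u : ℝ => Complex.exp (α * u * Complex.I)) ν := by
    intro ν _
    refine Integrable.of_bound (C := 1) (by fun_prop) (Filter.Eventually.of_forall fun u => ?_)
    rw [← Complex.ofReal_mul, Complex.norm_exp_ofReal_mul_I]
  have := isFiniteMeasure_withDensity_ofReal (integrableOn_telegraphDensity μ c t).hasFiniteIntegral
  have hdens : ∫ u, Complex.exp (α * u * Complex.I) ∂((volume.restrict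
      (Set.Ioo (-(c * t)) (c * t))).withDensity
        fun u => ENNReal.ofReal (telegraphDensity μ c t u)) =
      ((∫ u in (-(c * t))..(c * t), Real.cos (α * u) * telegraphDensity μ c t u : ℝ) : ℂ) := by
    rw [integral_withDensity_eq_integral_toReal_smul
      (continuous_telegraphDensity μ c t).measurable.ennreal_ofReal (by simp)]
    have e : ∫ u in Set.Ioo (-(c * t)) (c * t), (ENNReal.ofReal (telegraphDensity μ c t u)).toReal •
        Complex.exp (α * u * Complex.I) =
        ∫ u in Set.Ioo (-(c * t)) (c * t),
          (((Real.cos (α * u) * telegraphDensity μ c t u : ℝ) : ℂ) +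
            ((Real.sin (α * u) * telegraphDensity μ c t u : ℝ) : ℂ) * Complex.I) := by
      refine setIntegral_congr_fun measurableSet_Ioo fun u hu => ?_
      have hn := telegraphDensity_nonneg hμ hc ht (abs_le.2 ⟨hu.1.le, hu.2.le⟩)
      simp only [ENNReal.toReal_ofReal hn, hexp, Complex.real_smul]
      push_cast
      ring
    have hd := continuous_telegraphDensity μ c t
    rw [e, ← integral_Ioc_eq_integral_Ioo, ← intervalIntegral.integral_of_le (by linarith),
      intervalIntegral.integral_add (Continuous.intervalIntegrable (by fun_prop) _ _)
        (Continuous.intervalIntegrable (by fun_prop) _ _), intervalIntegral.integral_mul_const,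
      intervalIntegral.integral_ofReal, intervalIntegral.integral_ofReal,
      integral_sin_mul_telegraphDensity]
    simp
  rw [charFun_apply_real, telegraphLaw, integral_add_measure, integral_smul_measure,
    integral_add_measure, integral_dirac, integral_dirac, hdens,
    integral_cos_mul_telegraphDensity hc ht, hexp, hexp,
    ENNReal.toReal_ofReal (by positivity), mul_neg, Real.cos_neg, Real.sin_neg, Complex.real_smul]
  · push_cast; ring
  · exact hint _ inferInstance
  · exact hint _ inferInstance
  · exact hint _ (Measure.smul_finite _ ENNReal.ofReal_ne_top)
  · exact hint _ this

/-! ### The backward equation of the telegraph process -/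

/-- The characteristic function of a telegraph process started with velocity `ε c`, `ε = ± 1`. -/
noncomputable def telegraphChar (μ c α ε t : ℝ) : ℂ :=
  Real.exp (-(μ * t)) * (coshSqrt (μ ^ 2 - α ^ 2 * c ^ 2) t +
    μ * sinhSqrt (μ ^ 2 - α ^ 2 * c ^ 2) t +
    Complex.I * α * c * ε * sinhSqrt (μ ^ 2 - α ^ 2 * c ^ 2) t)

theorem telegraphChar_zero (μ c α ε : ℝ) : telegraphChar μ c α ε 0 = 1 := by
  simp [telegraphChar, coshSqrt_zero, sinhSqrt_zero]

/-- The backward equation for the telegraph process. -/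
theorem hasDerivAt_telegraphChar {ε : ℝ} (hε : ε ^ 2 = 1) (μ c α t : ℝ) :
    HasDerivAt (telegraphChar μ c α ε)
      (Complex.I * (α * c * ε : ℝ) * telegraphChar μ c α ε t +
        μ * (telegraphChar μ c α (-ε) t - telegraphChar μ c α ε t)) t := by
  have he : HasDerivAt (fun s : ℝ => Real.exp (-(μ * s))) (Real.exp (-(μ * t)) * (-μ)) t := by
    have := ((hasDerivAt_id t).const_mul μ).neg.exp
    simpa using this
  have hC := (hasDerivAt_coshSqrt (μ ^ 2 - α ^ 2 * c ^ 2) t).ofReal_comp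
  have hS := (hasDerivAt_sinhSqrt (μ ^ 2 - α ^ 2 * c ^ 2) t).ofReal_comp
  have := he.ofReal_comp.mul ((hC.add (hS.const_mul (μ : ℂ))).add
    (hS.const_mul (Complex.I * α * c * ε)))
  refine this.congr_deriv ?_
  have hε' : (ε : ℂ) ^ 2 = 1 := by exact_mod_cast hε
  unfold telegraphChar
  simp only [Pi.add_apply]
  push_cast
  -- The `-α² c²` in the radicand has to match `(I α c ε) ^ 2`, which takes `ε² = 1` and `I² = -1`.
  linear_combination (-(α : ℂ) ^ 2 * c ^ 2 * sinhSqrt (μ ^ 2 - α ^ 2 * c ^ 2) t *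
    Complex.exp (-(μ * t)) * Complex.I ^ 2) * hε' -
    (α : ℂ) ^ 2 * c ^ 2 * sinhSqrt (μ ^ 2 - α ^ 2 * c ^ 2) t *
      Complex.exp (-(μ * t)) * Complex.I_sq

theorem telegraphChar_add_neg {μ c t : ℝ} (hμ : 0 ≤ μ) (hc : 0 < c) (ht : 0 ≤ t) (α : ℝ) :
    telegraphChar μ c α 1 t + telegraphChar μ c α (-1) t =
      2 * charFun (telegraphLaw μ c t) α := by
  rw [charFun_telegraphLaw hμ hc ht]
  unfold telegraphChar
  push_cast
  ring

/-! ### Convergence of one-step schemes -/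

/-- A contractive approximation scheme, consistent of order two with the generator `A`, converges
to the solution of `G' = A G`. -/
theorem tendsto_iterate_of_generator {E : Type*} [NormedAddCommGroup E] [NormedSpace ℝ E]
    (A : E →L[ℝ] E) (G : ℝ → E) (hG : ∀ s, HasDerivAt G (A (G s)) s)
    (M : ℝ → E → E) (K : ℝ) (hM : ∀ h, 0 ≤ h → ∀ x y, ‖M h x - M h y‖ ≤ ‖x - y‖)
    (hMA : ∀ h, 0 ≤ h → ∀ x, ‖M h x - x - h • A x‖ ≤ K * h ^ 2 * ‖x‖) {t : ℝ} (ht : 0 ≤ t) :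
    Filter.Tendsto (fun m : ℕ => (M (t / m))^[m] (G 0)) Filter.atTop (nhds (G t)) := by
  have hcont : Continuous G := continuous_iff_continuousAt.2 fun s => (hG s).continuousAt
  obtain ⟨B, hB⟩ := isCompact_Icc.exists_bound_of_continuousOn (s := Set.Icc 0 t) hcont.continuousOn
  have hB0 : 0 ≤ B := (norm_nonneg _).trans (hB 0 ⟨le_rfl, ht⟩)
  have hlip : ∀ s ∈ Set.Icc 0 t, ∀ x ∈ Set.Icc 0 t, ‖G x - G s‖ ≤ ‖A‖ * B * ‖x - s‖ :=
    fun s hs x hx => (convex_Icc 0 t).norm_image_sub_le_of_norm_hasDerivWithin_le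
      (fun y _ => (hG y).hasDerivWithinAt)
      (fun y hy => (A.le_opNorm _).trans (by gcongr; exact hB y hy)) hs hx
  -- After subtracting the linear part, the derivative is `A (G x - G s)`, which is `O(h)` by the
  -- Lipschitz bound.
  have htaylor : ∀ s h, 0 ≤ s → 0 ≤ h → s + h ≤ t →
      ‖G (s + h) - G s - h • A (G s)‖ ≤ ‖A‖ ^ 2 * B * h ^ 2 := by
    intro s h hs hh hsh
    have := (convex_Icc s (s + h)).norm_image_sub_le_of_norm_hasDerivWithin_le
      (f := fun x => G x - (x - s) • A (G s)) (f' := fun x => A (G x) - A (G s))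
      (C := ‖A‖ ^ 2 * B * h) (x := s) (y := s + h)
      (fun y _ => by
        have h1 := ((hasDerivAt_id y).sub_const s).smul_const (A (G s))
        exact (((hG y).sub h1).congr_deriv (by rw [one_smul])).hasDerivWithinAt)
      (fun y hy => by
        rw [← map_sub]
        refine (A.le_opNorm _).trans ?_
        have h2 := hlip s ⟨hs, by linarith⟩ y ⟨hs.trans hy.1, hy.2.trans hsh⟩
        have h3 : ‖y - s‖ ≤ h := by
          rw [Real.norm_eq_abs, abs_of_nonneg (by linarith [hy.1])]; linarith [hy.2]
        calc ‖A‖ * ‖G y - G s‖ ≤ ‖A‖ * (‖A‖ * B * h) := by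
              gcongr; exact h2.trans (by gcongr)
          _ = _ := by ring)
      ⟨le_rfl, by linarith⟩ ⟨by linarith, le_rfl⟩
    simp only [add_sub_cancel_left, sub_self, zero_smul, sub_zero, Real.norm_eq_abs,
      abs_of_nonneg hh] at this
    calc _ = ‖G (s + h) - h • A (G s) - G s‖ := by congr 1; abel
      _ ≤ _ := this
      _ = _ := by ring
  -- Contractivity keeps earlier errors from growing, so `n` local errors of order `h ^ 2` just add
  -- up; with `h = t / m` and `n = m` the total is `O(1 / m)`.
  have hstep : ∀ h, 0 ≤ h → ∀ n : ℕ, n * h ≤ t →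
      ‖(M h)^[n] (G 0) - G (n * h)‖ ≤ n * ((|K| + ‖A‖ ^ 2) * B * h ^ 2) := by
    intro h hh n
    induction n with
    | zero => intro; simp
    | succ n ih =>
      intro hn
      push_cast at hn ⊢
      have hnh : 0 ≤ n * h := by positivity
      have e : (M h)^[n + 1] (G 0) - G ((n + 1) * h) =
          (M h ((M h)^[n] (G 0)) - M h (G (n * h))) + (M h (G (n * h)) - G (n * h) - h • A (G (n * h))) -
            (G (n * h + h) - G (n * h) - h • A (G (n * h))) := by
        rw [Function.iterate_succ_apply', add_mul, one_mul]
        abel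
      rw [e]
      have b1 := (hM h hh ((M h)^[n] (G 0)) (G (n * h))).trans (ih (by linarith))
      have b2 := hMA h hh (G (n * h))
      have b3 := htaylor (n * h) h hnh hh (by linarith)
      have b4 : K * h ^ 2 * ‖G (n * h)‖ ≤ |K| * h ^ 2 * B := by
        gcongr
        · exact le_abs_self K
        · exact hB _ ⟨hnh, by linarith⟩
      refine (norm_sub_le _ _).trans ?_
      have b5 := norm_add_le (M h ((M h)^[n] (G 0)) - M h (G (n * h)))
        (M h (G (n * h)) - G (n * h) - h • A (G (n * h)))
      nlinarith
  rw [tendsto_iff_norm_sub_tendsto_zero]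
  refine squeeze_zero' (g := fun m : ℕ => (|K| + ‖A‖ ^ 2) * B * t ^ 2 * (1 / (m : ℝ)))
    (Filter.Eventually.of_forall fun _ => norm_nonneg _) ?_ ?_
  · filter_upwards [Filter.eventually_gt_atTop 0] with m hm
    have hm' : (0 : ℝ) < m := by exact_mod_cast hm
    have e : (m : ℝ) * (t / m) = t := by field_simp
    have := hstep (t / m) (by positivity) m e.le
    rw [e] at this
    refine this.trans (le_of_eq ?_)
    field_simp
  · simpa using tendsto_one_div_atTop_nhds_zero_nat.const_mul ((|K| + ‖A‖ ^ 2) * B * t ^ 2)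

/-! ### Second-order expansions: Poisson means and phases -/

theorem hasSum_poisson_mul_id (r : ℝ) :
    HasSum (fun n : ℕ => Real.exp (-r) * r ^ n / n.factorial * n) r := by
  rw [← hasSum_nat_add_iff' 1]
  have h := ((NormedSpace.expSeries_div_hasSum_exp r).mul_left (Real.exp (-r))).mul_left r
  rw [← Real.exp_eq_exp_ℝ, ← Real.exp_add, neg_add_cancel, Real.exp_zero, mul_one] at h
  simp only [Finset.range_one, Finset.sum_singleton, Nat.cast_zero, mul_zero, sub_zero]
  refine h.congr_fun fun n => ?_
  rw [Nat.factorial_succ]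
  have : (n.factorial : ℝ) ≠ 0 := by positivity
  push_cast
  field_simp
  ring

theorem hasSum_poisson_mul_id_mul_pred (r : ℝ) :
    HasSum (fun n : ℕ => Real.exp (-r) * r ^ n / n.factorial * (n * (n - 1))) (r ^ 2) := by
  rw [← hasSum_nat_add_iff' 2]
  have h := ((NormedSpace.expSeries_div_hasSum_exp r).mul_left (Real.exp (-r))).mul_left (r ^ 2)
  rw [← Real.exp_eq_exp_ℝ, ← Real.exp_add, neg_add_cancel, Real.exp_zero, mul_one] at h
  simp only [Finset.sum_range_succ, Finset.range_zero, Finset.sum_empty, Nat.cast_zero,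
    Nat.cast_one, sub_self, zero_mul, mul_zero, add_zero, sub_zero]
  refine h.congr_fun fun n => ?_
  rw [Nat.factorial_succ, Nat.factorial_succ]
  have : (n.factorial : ℝ) ≠ 0 := by positivity
  push_cast
  field_simp
  ring

theorem integrable_poissonMeasure_of_bound {E : Type*} [NormedAddCommGroup E] (r : ℝ≥0)
    {φ : ℕ → E} {B : ℝ} (hφ : ∀ k, ‖φ k‖ ≤ B) : Integrable φ (poissonMeasure r) :=
  Integrable.of_bound StronglyMeasurable.of_discrete.aestronglyMeasurable B
    (Filter.Eventually.of_forall hφ)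

/-- The function `φ 0 + n (φ 1 - φ 0)` agrees with `φ n` at `0` and `1`, so the error is controlled
by `n (n - 1)`, whose Poisson mean is `r ^ 2`. -/
theorem norm_integral_poissonMeasure_sub_le {E : Type*} [NormedAddCommGroup E] [NormedSpace ℝ E]
    [CompleteSpace E] (r : ℝ≥0) {φ : ℕ → E} {B : ℝ} (hφ : ∀ k, ‖φ k‖ ≤ B) :
    ‖∫ k, φ k ∂(poissonMeasure r) - φ 0 - (r : ℝ) • (φ 1 - φ 0)‖ ≤ 3 * B * r ^ 2 := by
  have hB : 0 ≤ B := (norm_nonneg _).trans (hφ 0)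
  have h1 := hasSum_integral_poissonMeasure (integrable_poissonMeasure_of_bound r hφ)
  have h2 := (hasSum_one_poissonMeasure r).smul_const (φ 0)
  have h3 := (hasSum_poisson_mul_id r).smul_const (φ 1 - φ 0)
  have h := (h1.sub h2).sub h3
  rw [one_smul] at h
  refine h.norm_le_of_bounded ((hasSum_poisson_mul_id_mul_pred r).mul_left (3 * B)) fun n => ?_
  have e : (Real.exp (-r) * (r : ℝ) ^ n / n.factorial) • φ n -
      (Real.exp (-r) * (r : ℝ) ^ n / n.factorial) • φ 0 -
      (Real.exp (-r) * (r : ℝ) ^ n / n.factorial * n) • (φ 1 - φ 0) =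
      (Real.exp (-r) * (r : ℝ) ^ n / n.factorial) • (φ n - φ 0 - (n : ℝ) • (φ 1 - φ 0)) := by
    simp only [mul_smul, smul_sub]
  rw [e, norm_smul, Real.norm_of_nonneg (by positivity)]
  -- The triangle inequality gives `2 B (n + 1)`; the constant `3` makes the bound an equality with
  -- this at `n = 2`.
  have key : ‖φ n - φ 0 - (n : ℝ) • (φ 1 - φ 0)‖ ≤ 3 * B * (n * (n - 1)) := by
    match n with
    | 0 => simp
    | 1 => simp
    | n + 2 =>
      have b1 := norm_sub_le (φ (n + 2) - φ 0) (((n + 2 : ℕ) : ℝ) • (φ 1 - φ 0))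
      have b2 := norm_sub_le (φ (n + 2)) (φ 0)
      have b3 := norm_sub_le (φ 1) (φ 0)
      rw [norm_smul, Real.norm_of_nonneg (Nat.cast_nonneg _)] at b1
      have b4 : ((n + 2 : ℕ) : ℝ) * ‖φ 1 - φ 0‖ ≤ ((n + 2 : ℕ) : ℝ) * (2 * B) := by
        gcongr; linarith [hφ 1, hφ 0]
      have hn : (0 : ℝ) ≤ n := Nat.cast_nonneg n
      have b5 : (0 : ℝ) ≤ B * n := by positivity
      have b6 : (0 : ℝ) ≤ B * n * n := by positivity
      push_cast at b1 b4 ⊢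
      nlinarith [hφ (n + 2), hφ 0]
  calc _ ≤ Real.exp (-r) * (r : ℝ) ^ n / n.factorial * (3 * B * (n * (n - 1))) := by gcongr
    _ = _ := by ring

theorem norm_exp_I_mul_sub_le (x : ℝ) : ‖Complex.exp (Complex.I * x) - 1‖ ≤ |x| := by
  simpa using Real.norm_exp_I_mul_ofReal_sub_one_le (x := x)

theorem norm_exp_I_mul_sub_sub_le (x : ℝ) :
    ‖Complex.exp (Complex.I * x) - 1 - Complex.I * x‖ ≤ x ^ 2 := by
  have := (convex_uIcc (0 : ℝ) x).norm_image_sub_le_of_norm_hasDerivWithin_le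
    (f := fun y : ℝ => Complex.exp (Complex.I * y) - Complex.I * y)
    (f' := fun y : ℝ => Complex.I * (Complex.exp (Complex.I * y) - 1))
    (C := |x|) (x := 0) (y := x)
    (fun y _ => by
      have h := ((hasDerivAt_id y).ofReal_comp.const_mul Complex.I)
      refine ((h.cexp.sub h).congr_deriv ?_).hasDerivWithinAt
      simp; ring)
    (fun y hy => by
      rw [norm_mul, Complex.norm_I, one_mul]
      refine (norm_exp_I_mul_sub_le y).trans ?_
      simpa using Set.abs_sub_left_of_mem_uIcc hy)
    Set.left_mem_uIcc Set.right_mem_uIcc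
  simp only [Complex.ofReal_zero, mul_zero, Complex.exp_zero, sub_zero, Real.norm_eq_abs,
    abs_mul_abs_self] at this
  calc _ = ‖Complex.exp (Complex.I * x) - Complex.I * x - 1‖ := by congr 1; ring
    _ ≤ _ := this
    _ = _ := by ring

/-! ### Directions as pairs of signs; the generator and its semigroup -/

/-- The sign of the velocity along `x + y` of a particle moving along `d_j`. -/
def signU : Fin 4 → ℝ := ![1, 1, -1, -1]

/-- The sign of the velocity along `x - y` of a particle moving along `d_j`. -/
def signV : Fin 4 → ℝ := ![1, -1, -1, 1]

theorem dirVec_fst_add_snd (j : Fin 4) : (dirVec j).1 + (dirVec j).2 = signU j := by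
  have h2 : Real.pi * 2 / 2 = Real.pi := by ring
  have h3 : Real.pi * 3 / 2 = Real.pi + Real.pi / 2 := by ring
  fin_cases j <;>
    simp [dirVec, signU, h2, h3, Real.cos_add, Real.sin_add]

theorem dirVec_fst_sub_snd (j : Fin 4) : (dirVec j).1 - (dirVec j).2 = signV j := by
  have h2 : Real.pi * 2 / 2 = Real.pi := by ring
  have h3 : Real.pi * 3 / 2 = Real.pi + Real.pi / 2 := by ring
  fin_cases j <;>
    simp [dirVec, signV, h2, h3, Real.cos_add, Real.sin_add]

theorem turnProb_nonneg {p : ℝ} (hp0 : 0 ≤ p) (hp1 : p ≤ 1) (i j : Fin 4) : 0 ≤ turnProb p i j := by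
  unfold turnProb
  split_ifs <;> linarith

theorem turnProb_eq (p : ℝ) : turnProb p =
    ![![0, p, 0, 1 - p], ![p, 0, 1 - p, 0], ![0, 1 - p, 0, p], ![1 - p, 0, p, 0]] := by
  have h : (-1 : Fin 4) = 3 := rfl
  ext i j
  fin_cases i <;> fin_cases j <;> simp [turnProb, h]

theorem sum_turnProb (p : ℝ) (i : Fin 4) : ∑ j, turnProb p i j = 1 := by
  rw [turnProb_eq]
  fin_cases i <;> simp [Fin.sum_univ_four]

/-- The transition operator of the chain of directions. -/
noncomputable def turnOp (p : ℝ) : (Fin 4 → ℂ) →ₗ[ℝ] (Fin 4 → ℂ) where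
  toFun g i := ∑ j, (turnProb p i j : ℂ) * g j
  map_add' f g := by ext i; simp [mul_add, Finset.sum_add_distrib]
  map_smul' r g := by
    ext i
    simp only [Pi.smul_apply, Complex.real_smul, RingHom.id_apply, Finset.mul_sum]
    exact Finset.sum_congr rfl fun j _ => by ring

theorem turnOp_apply (p : ℝ) (g : Fin 4 → ℂ) (i : Fin 4) :
    turnOp p g i = ∑ j, (turnProb p i j : ℂ) * g j := rfl

theorem norm_turnOp_le {p : ℝ} (hp0 : 0 ≤ p) (hp1 : p ≤ 1) (g : Fin 4 → ℂ) :
    ‖turnOp p g‖ ≤ ‖g‖ := by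
  refine (pi_norm_le_iff_of_nonneg (norm_nonneg g)).2 fun i => ?_
  rw [turnOp_apply]
  calc ‖∑ j, (turnProb p i j : ℂ) * g j‖ ≤ ∑ j, ‖(turnProb p i j : ℂ) * g j‖ := norm_sum_le _ _
    _ ≤ ∑ j, turnProb p i j * ‖g‖ := by
        refine Finset.sum_le_sum fun j _ => ?_
        have := turnProb_nonneg hp0 hp1 i j
        rw [norm_mul, Complex.norm_real, Real.norm_of_nonneg this]
        gcongr
        exact norm_le_pi_norm g j
    _ = ‖g‖ := by rw [← Finset.sum_mul, sum_turnProb, one_mul]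

theorem norm_iterate_turnOp_le {p : ℝ} (hp0 : 0 ≤ p) (hp1 : p ≤ 1) (g : Fin 4 → ℂ) (k : ℕ) :
    ‖(turnOp p)^[k] g‖ ≤ ‖g‖ := by
  induction k with
  | zero => simp
  | succ k ih =>
    rw [Function.iterate_succ_apply']
    exact (norm_turnOp_le hp0 hp1 _).trans ih

/-- The transition operator over a time span with a Poisson number of switches of mean `r`. -/
noncomputable def poissonTurnOp (p : ℝ) (r : ℝ≥0) (g : Fin 4 → ℂ) : Fin 4 → ℂ :=
  fun i => ∫ k, (turnOp p)^[k] g i ∂(poissonMeasure r)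

theorem integrable_iterate_turnOp {p : ℝ} (hp0 : 0 ≤ p) (hp1 : p ≤ 1) (r : ℝ≥0) (g : Fin 4 → ℂ)
    (i : Fin 4) : Integrable (fun k => (turnOp p)^[k] g i) (poissonMeasure r) :=
  integrable_poissonMeasure_of_bound r fun k =>
    (norm_le_pi_norm _ i).trans (norm_iterate_turnOp_le hp0 hp1 g k)

theorem norm_poissonTurnOp_sub_le {p : ℝ} (hp0 : 0 ≤ p) (hp1 : p ≤ 1) (r : ℝ≥0)
    (f g : Fin 4 → ℂ) : ‖poissonTurnOp p r f - poissonTurnOp p r g‖ ≤ ‖f - g‖ := by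
  refine (pi_norm_le_iff_of_nonneg (norm_nonneg _)).2 fun i => ?_
  rw [Pi.sub_apply]
  unfold poissonTurnOp
  rw [← integral_sub (integrable_iterate_turnOp hp0 hp1 r f i)
    (integrable_iterate_turnOp hp0 hp1 r g i)]
  refine (norm_integral_le_of_norm_le_const (C := ‖f - g‖)
    (Filter.Eventually.of_forall fun k => ?_)).trans (by simp)
  rw [← Pi.sub_apply, ← iterate_map_sub]
  exact (norm_le_pi_norm _ i).trans (norm_iterate_turnOp_le hp0 hp1 _ k)

theorem norm_poissonTurnOp_sub_sub_le {p : ℝ} (hp0 : 0 ≤ p) (hp1 : p ≤ 1) (r : ℝ≥0)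
    (g : Fin 4 → ℂ) (i : Fin 4) :
    ‖poissonTurnOp p r g i - g i - r * (turnOp p g i - g i)‖ ≤ 3 * ‖g‖ * r ^ 2 := by
  have := norm_integral_poissonMeasure_sub_le r (φ := fun k => (turnOp p)^[k] g i) (B := ‖g‖)
    fun k => (norm_le_pi_norm _ i).trans (norm_iterate_turnOp_le hp0 hp1 g k)
  simpa [poissonTurnOp] using this

/-- One step of the discretized motion: the phase `exp (i h b)` collected over a time span `h`,
followed by the switches during that span. -/
noncomputable def stepOp (lam p : ℝ) (b : Fin 4 → ℝ) (h : ℝ) (g : Fin 4 → ℂ) : Fin 4 → ℂ :=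
  fun i => Complex.exp (Complex.I * (h * b i : ℝ)) *
    poissonTurnOp p (lam.toNNReal * h.toNNReal) g i

theorem norm_exp_I_mul_ofReal_eq_one (x : ℝ) : ‖Complex.exp (Complex.I * x)‖ = 1 := by
  rw [mul_comm, Complex.norm_exp_ofReal_mul_I]

theorem norm_stepOp_sub_le {p : ℝ} (hp0 : 0 ≤ p) (hp1 : p ≤ 1) (lam : ℝ) (b : Fin 4 → ℝ) (h : ℝ)
    (f g : Fin 4 → ℂ) : ‖stepOp lam p b h f - stepOp lam p b h g‖ ≤ ‖f - g‖ := by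
  refine (pi_norm_le_iff_of_nonneg (norm_nonneg _)).2 fun i => ?_
  rw [Pi.sub_apply]
  unfold stepOp
  rw [← mul_sub, norm_mul, norm_exp_I_mul_ofReal_eq_one, one_mul, ← Pi.sub_apply]
  exact (norm_le_pi_norm _ i).trans (norm_poissonTurnOp_sub_le hp0 hp1 _ f g)

/-- The generator of the motion in Fourier variables. -/
noncomputable def motionGenerator (lam p : ℝ) (b : Fin 4 → ℝ) : (Fin 4 → ℂ) →L[ℝ] (Fin 4 → ℂ) :=
  LinearMap.toContinuousLinearMap
    { toFun := fun g i => Complex.I * b i * g i + lam * (turnOp p g i - g i)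
      map_add' := fun f g => by
        ext i; simp only [map_add, Pi.add_apply]; ring
      map_smul' := fun r g => by
        ext i
        simp only [map_smul, Pi.smul_apply, Complex.real_smul, RingHom.id_apply]
        ring }

theorem motionGenerator_apply (lam p : ℝ) (b : Fin 4 → ℝ) (g : Fin 4 → ℂ) (i : Fin 4) :
    motionGenerator lam p b g i = Complex.I * b i * g i + lam * (turnOp p g i - g i) := rfl

theorem norm_stepOp_sub_sub_le {lam p : ℝ} (hlam : 0 ≤ lam) (hp0 : 0 ≤ p) (hp1 : p ≤ 1)
    (b : Fin 4 → ℝ) {h : ℝ} (hh : 0 ≤ h) (g : Fin 4 → ℂ) :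
    ‖stepOp lam p b h g - g - h • motionGenerator lam p b g‖ ≤
      (3 * lam ^ 2 + ‖b‖ ^ 2 + 2 * ‖b‖ * lam) * h ^ 2 * ‖g‖ := by
  refine (pi_norm_le_iff_of_nonneg (by positivity)).2 fun i => ?_
  set r : ℝ≥0 := lam.toNNReal * h.toNNReal with hr
  have hr' : (r : ℝ) = lam * h := by simp [hr, hlam, hh]
  set w := Complex.exp (Complex.I * (h * b i : ℝ)) with hw
  set Q := poissonTurnOp p r g i with hQ
  -- Three errors of order `h ^ 2`: the Poisson mean, the phase, and the interaction of the two
  -- first-order terms.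
  have e : (stepOp lam p b h g - g - h • motionGenerator lam p b g) i =
      w * (Q - g i - (r : ℝ) * (turnOp p g i - g i)) +
        (w - 1 - Complex.I * (h * b i : ℝ)) * g i +
        (w - 1) * ((r : ℝ) * (turnOp p g i - g i)) := by
    simp only [Pi.sub_apply, Pi.smul_apply, motionGenerator_apply, Complex.real_smul, stepOp, hr']
    rw [← hr, ← hw, ← hQ]
    push_cast
    ring
  have hbi : |b i| ≤ ‖b‖ := norm_le_pi_norm b i
  have hgi : ‖g i‖ ≤ ‖g‖ := norm_le_pi_norm g i
  have hTi : ‖turnOp p g i‖ ≤ ‖g‖ := (norm_le_pi_norm _ i).trans (norm_turnOp_le hp0 hp1 g)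
  have b1 : ‖w * (Q - g i - (r : ℝ) * (turnOp p g i - g i))‖ ≤ 3 * ‖g‖ * (lam * h) ^ 2 := by
    rw [norm_mul, norm_exp_I_mul_ofReal_eq_one, one_mul, ← hr']
    exact norm_poissonTurnOp_sub_sub_le hp0 hp1 r g i
  have b2 : ‖(w - 1 - Complex.I * (h * b i : ℝ)) * g i‖ ≤ (h * ‖b‖) ^ 2 * ‖g‖ := by
    rw [norm_mul]
    refine mul_le_mul ((norm_exp_I_mul_sub_sub_le _).trans ?_) hgi (norm_nonneg _) (by positivity)
    rw [← sq_abs, abs_mul, abs_of_nonneg hh]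
    gcongr
  have b3 : ‖(w - 1) * ((r : ℝ) * (turnOp p g i - g i))‖ ≤ h * ‖b‖ * (lam * h * (2 * ‖g‖)) := by
    rw [norm_mul, norm_mul, hr', Complex.norm_real, Real.norm_of_nonneg (by positivity)]
    refine mul_le_mul ((norm_exp_I_mul_sub_le _).trans ?_) ?_ (by positivity) (by positivity)
    · rw [abs_mul, abs_of_nonneg hh]; gcongr
    · gcongr
      exact (norm_sub_le _ _).trans (by linarith)
  rw [e]
  refine (norm_add₃_le).trans ?_
  linarith

/-- The Fourier transform of the motion started along `d_j`, in the variables dual to `x + y` and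
`x - y`. -/
noncomputable def motionChar (lam p c α β t : ℝ) : Fin 4 → ℂ := fun j =>
  telegraphChar (lam * (1 - p)) c α (signU j) t * telegraphChar (lam * p) c β (signV j) t

/-- This is where the motion decouples. From every direction a turn reverses `signU` with
probability `1 - p` and `signV` with probability `p`, never both, so the generator is a sum of two
telegraph generators and the product rule produces it. -/
theorem hasDerivAt_motionChar (lam p c α β t : ℝ) :
    HasDerivAt (motionChar lam p c α β)
      (motionGenerator lam p (fun j => c * (α * signU j + β * signV j))
        (motionChar lam p c α β t)) t := by
  refine hasDerivAt_pi.2 fun j => ?_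
  have hU : signU j ^ 2 = 1 := by fin_cases j <;> simp [signU]
  have hV : signV j ^ 2 = 1 := by fin_cases j <;> simp [signV]
  refine ((hasDerivAt_telegraphChar hU (lam * (1 - p)) c α t).mul
    (hasDerivAt_telegraphChar hV (lam * p) c β t)).congr_deriv ?_
  rw [motionGenerator_apply, turnOp_apply, Fin.sum_univ_four, turnProb_eq]
  fin_cases j <;> simp [motionChar, signU, signV] <;> ring

theorem tendsto_iterate_stepOp {lam p : ℝ} (hlam : 0 ≤ lam) (hp0 : 0 ≤ p) (hp1 : p ≤ 1)
    (c α β : ℝ) {t : ℝ} (ht : 0 ≤ t) :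
    Filter.Tendsto (fun m : ℕ =>
      (stepOp lam p (fun j => c * (α * signU j + β * signV j)) (t / m))^[m] (fun _ => 1))
      Filter.atTop (nhds (motionChar lam p c α β t)) := by
  have h := tendsto_iterate_of_generator _ _ (hasDerivAt_motionChar lam p c α β) _ _
    (fun h _ => norm_stepOp_sub_le hp0 hp1 lam (fun j => c * (α * signU j + β * signV j)) h)
    (fun h hh => norm_stepOp_sub_sub_le hlam hp0 hp1 _ hh) ht
  have h0 : motionChar lam p c α β 0 = fun _ => 1 := by
    ext j; simp [motionChar, telegraphChar_zero]
  rwa [h0] at h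

/-- The four directions run once through all pairs of signs, so the sum of products is a product of
sums. -/
theorem sum_motionChar {lam p c t : ℝ} (hlam : 0 ≤ lam) (hp0 : 0 ≤ p) (hp1 : p ≤ 1) (hc : 0 < c)
    (ht : 0 ≤ t) (α β : ℝ) :
    ∑ j, motionChar lam p c α β t j =
      4 * (charFun (telegraphLaw (lam * (1 - p)) c t) α *
        charFun (telegraphLaw (lam * p) c t) β) := by
  have hU := telegraphChar_add_neg (mul_nonneg hlam (sub_nonneg.2 hp1)) hc ht α
  have hV := telegraphChar_add_neg (mul_nonneg hlam hp0) hc ht β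
  have e : (4 : ℂ) * (charFun (telegraphLaw (lam * (1 - p)) c t) α *
        charFun (telegraphLaw (lam * p) c t) β) =
      (2 * charFun (telegraphLaw (lam * (1 - p)) c t) α) *
        (2 * charFun (telegraphLaw (lam * p) c t) β) := by ring
  rw [e, ← hU, ← hV, Fin.sum_univ_four]
  simp [motionChar, signU, signV]
  ring

/-! ### The Markov property of the directions -/

variable {Ω : Type*} [MeasurableSpace Ω] {P : Measure Ω}

theorem integral_comp_eq_sum {S : Type*} [Fintype S] [MeasurableSpace S]
    [MeasurableSingletonClass S] [IsFiniteMeasure P] {Z : Ω → S} (hZ : Measurable Z) (H : S → ℂ) :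
    ∫ ω, H (Z ω) ∂P = ∑ s, (P.real (Z ⁻¹' {s}) : ℂ) * H s := by
  rw [← integral_map hZ.aemeasurable StronglyMeasurable.of_discrete.aestronglyMeasurable,
    integral_fintype .of_finite]
  refine Finset.sum_congr rfl fun s _ => ?_
  rw [map_measureReal_apply hZ (measurableSet_singleton s), Complex.real_smul]

theorem integral_initialDirection [IsProbabilityMeasure P] {ξ : ℕ → Ω → Fin 4} {p : ℝ}
    (hξ : IsDirectionChain ξ p P) (g : Fin 4 → ℂ) :
    ∫ ω, g (ξ 0 ω) ∂P = 1 / 4 * ∑ j, g j := by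
  rw [integral_comp_eq_sum (hξ.measurable 0), Finset.mul_sum]
  refine Finset.sum_congr rfl fun j _ => ?_
  have h := hξ.law_path 0 fun _ => j
  have e : {ω | ∀ k ≤ 0, ξ k ω = j} = ξ 0 ⁻¹' {j} := by ext ω; simp
  rw [e] at h
  rw [h]
  simp

/-- As `F` reads only the first `n + 1` directions, both sides are finite sums over paths, and the
path law gains one factor `turnProb` at the extra step. -/
theorem integral_mul_next_direction [IsProbabilityMeasure P] {ξ : ℕ → Ω → Fin 4} {p : ℝ}
    (hξ : IsDirectionChain ξ p P) (n : ℕ) (F : (ℕ → Fin 4) → ℂ)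
    (hF : ∀ x y : ℕ → Fin 4, (∀ k ≤ n, x k = y k) → F x = F y) (g : Fin 4 → ℂ) :
    ∫ ω, F (fun k => ξ k ω) * g (ξ (n + 1) ω) ∂P =
      ∫ ω, F (fun k => ξ k ω) * turnOp p g (ξ n ω) ∂P := by
  let X : Ω → (Fin (n + 1) → Fin 4) := fun ω i => ξ i ω
  have hX : Measurable X := measurable_pi_lambda _ fun i => hξ.measurable i
  -- A finite path is continued by the constant `j`, so the entry at `n + 1` is the next direction.
  let ext : (Fin (n + 1) → Fin 4) → Fin 4 → ℕ → Fin 4 := fun a j k =>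
    if h : k ≤ n then a ⟨k, Nat.lt_succ_of_le h⟩ else j
  have hext : ∀ ω j, F (fun k => ξ k ω) = F (ext (X ω) j) := by
    intro ω j
    refine hF _ _ fun k hk => ?_
    simp [ext, X, hk]
  have hpath : ∀ a j, P.real (X ⁻¹' {a}) =
      1 / 4 * ∏ k ∈ Finset.range n, turnProb p (ext a j k) (ext a j (k + 1)) := by
    intro a j
    rw [← hξ.law_path n (ext a j)]
    congr 1
    ext ω
    simp only [Set.mem_preimage, Set.mem_singleton_iff, Set.mem_ofPred_eq]
    constructor
    · rintro rfl k hk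
      simp [ext, X, hk]
    · intro h
      ext1 i
      have := h i (Nat.le_of_lt_succ i.2)
      simpa [ext, X, Nat.le_of_lt_succ i.2] using this
  have hpath' : ∀ a j, P.real ((fun ω => (X ω, ξ (n + 1) ω)) ⁻¹' {(a, j)}) =
      P.real (X ⁻¹' {a}) * turnProb p (a (Fin.last n)) j := by
    intro a j
    have e1 : ext a j n = a (Fin.last n) := by simp [ext, Fin.last]
    have e2 : ext a j (n + 1) = j := by simp [ext]
    have h := hξ.law_path (n + 1) (ext a j)
    rw [Finset.prod_range_succ, ← mul_assoc, ← hpath, e1, e2] at h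
    rw [← h]
    congr 1
    ext ω
    simp only [Set.mem_preimage, Set.mem_singleton_iff, Set.mem_ofPred_eq, Prod.mk.injEq]
    constructor
    · rintro ⟨rfl, rfl⟩ k hk
      rcases Nat.lt_or_eq_of_le hk with hk | rfl
      · simp [ext, X, Nat.le_of_lt_succ hk]
      · simp [ext]
    · intro h
      refine ⟨?_, ?_⟩
      · ext1 i
        have := h i (by omega)
        simpa [ext, X, Nat.le_of_lt_succ i.2] using this
      · rw [h (n + 1) le_rfl, e2]
  have hl : ∫ ω, F (fun k => ξ k ω) * g (ξ (n + 1) ω) ∂P =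
      ∫ ω, (fun s : (Fin (n + 1) → Fin 4) × Fin 4 => F (ext s.1 0) * g s.2)
        (X ω, ξ (n + 1) ω) ∂P :=
    integral_congr_ae (Filter.Eventually.of_forall fun ω => by simp only [hext ω 0])
  have hr : ∫ ω, F (fun k => ξ k ω) * turnOp p g (ξ n ω) ∂P =
      ∫ ω, (fun a : Fin (n + 1) → Fin 4 => F (ext a 0) * turnOp p g (a (Fin.last n))) (X ω) ∂P :=
    integral_congr_ae (Filter.Eventually.of_forall fun ω => by simp only [hext ω 0]; rfl)
  rw [hl, hr, integral_comp_eq_sum (hX.prodMk (hξ.measurable (n + 1)))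
      (fun s : (Fin (n + 1) → Fin 4) × Fin 4 => F (ext s.1 0) * g s.2),
    integral_comp_eq_sum hX
      (fun a : Fin (n + 1) → Fin 4 => F (ext a 0) * turnOp p g (a (Fin.last n))), Fintype.sum_prod_type]
  refine Finset.sum_congr rfl fun a _ => ?_
  rw [turnOp_apply, Finset.mul_sum, Finset.mul_sum]
  refine Finset.sum_congr rfl fun j _ => ?_
  rw [hpath']
  push_cast
  ring

/-- The Markov property of the chain of directions. -/
theorem integral_mul_later_direction [IsProbabilityMeasure P] {ξ : ℕ → Ω → Fin 4} {p : ℝ}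
    (hξ : IsDirectionChain ξ p P) (n : ℕ) (F : (ℕ → Fin 4) → ℂ)
    (hF : ∀ x y : ℕ → Fin 4, (∀ k ≤ n, x k = y k) → F x = F y) (k : ℕ) (g : Fin 4 → ℂ) :
    ∫ ω, F (fun k => ξ k ω) * g (ξ (n + k) ω) ∂P =
      ∫ ω, F (fun k => ξ k ω) * (turnOp p)^[k] g (ξ n ω) ∂P := by
  induction k generalizing g with
  | zero => simp
  | succ k ih =>
    rw [Function.iterate_succ_apply, ← ih, ← add_assoc]
    exact integral_mul_next_direction hξ (n + k) F
      (fun x y h => hF x y fun i hi => h i (hi.trans (Nat.le_add_right n k))) g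

theorem integral_comp_indepFun [IsProbabilityMeasure P] {α β : Type*} [MeasurableSpace α]
    [MeasurableSpace β] {X : Ω → α} {Y : Ω → β} (hX : Measurable X) (hY : Measurable Y)
    (h : IndepFun X Y P) {Φ : α → β → ℂ} (hΦ : Measurable fun z : α × β => Φ z.1 z.2) {C : ℝ}
    (hC : ∀ a b, ‖Φ a b‖ ≤ C) :
    ∫ ω, Φ (X ω) (Y ω) ∂P = ∫ ω, ∫ ω', Φ (X ω) (Y ω') ∂P ∂P := by
  have hpr : IsProbabilityMeasure (P.map X) := Measure.isProbabilityMeasure_map hX.aemeasurable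
  have hpr' : IsProbabilityMeasure (P.map Y) := Measure.isProbabilityMeasure_map hY.aemeasurable
  have h1 := integral_map (μ := P) (hX.prodMk hY).aemeasurable
    (f := fun z : α × β => Φ z.1 z.2) hΦ.aestronglyMeasurable
  have hint : Integrable (fun z : α × β => Φ z.1 z.2) ((P.map X).prod (P.map Y)) :=
    Integrable.of_bound hΦ.aestronglyMeasurable C (Filter.Eventually.of_forall fun z => hC z.1 z.2)
  rw [(indepFun_iff_map_prod_eq_prod_map_map hX.aemeasurable hY.aemeasurable).1 h,
    integral_prod _ hint, integral_map hX.aemeasurable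
      hΦ.stronglyMeasurable.integral_prod_right.aestronglyMeasurable] at h1
  rw [← h1]
  refine integral_congr_ae (Filter.Eventually.of_forall fun ω => ?_)
  exact integral_map hY.aemeasurable
    (hΦ.comp (measurable_const.prodMk measurable_id)).aestronglyMeasurable

theorem measurable_apply_index {S : Type*} [MeasurableSpace S] :
    Measurable fun z : ℕ × (ℕ → S) => z.2 z.1 :=
  measurable_from_prod_countable_right fun n => measurable_pi_apply n

/-! ### The discretised motion -/

/-- The number of switches in the first `k` steps, when `κ i` of them occur in step `i`. -/
def switchCount (κ : ℕ → ℕ) (k : ℕ) : ℕ := ∑ i ∈ Finset.range k, κ i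

theorem measurable_switchCount (k : ℕ) : Measurable fun κ : ℕ → ℕ => switchCount κ k :=
  Finset.measurable_sum _ fun i _ => measurable_pi_apply i

theorem switchCount_mono (κ : ℕ → ℕ) : Monotone (switchCount κ) :=
  fun _ _ h => Finset.sum_le_sum_of_subset (Finset.range_mono h)

/-- The phases collected along the first `m` steps. -/
noncomputable def phaseProd (w : Fin 4 → ℂ) (m : ℕ) (κ : ℕ → ℕ) (x : ℕ → Fin 4) : ℂ :=
  ∏ k ∈ Finset.range m, w (x (switchCount κ k))

theorem measurable_direction_switchCount (k : ℕ) :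
    Measurable fun z : (ℕ → ℕ) × (ℕ → Fin 4) => z.2 (switchCount z.1 k) :=
  measurable_apply_index.comp (((measurable_switchCount k).comp measurable_fst).prodMk
    measurable_snd)

theorem measurable_phaseProd (w : Fin 4 → ℂ) (m : ℕ) :
    Measurable fun z : (ℕ → ℕ) × (ℕ → Fin 4) => phaseProd w m z.1 z.2 :=
  Finset.measurable_prod _ fun k _ =>
    (Measurable.of_discrete (f := w)).comp (measurable_direction_switchCount k)

theorem norm_phaseProd {w : Fin 4 → ℂ} (hw : ∀ j, ‖w j‖ = 1) (m : ℕ) (κ : ℕ → ℕ)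
    (x : ℕ → Fin 4) : ‖phaseProd w m κ x‖ = 1 := by
  rw [phaseProd, norm_prod]
  exact Finset.prod_eq_one fun _ _ => hw _

theorem norm_phaseProd_mul_le {w : Fin 4 → ℂ} (hw : ∀ j, ‖w j‖ = 1) (m : ℕ) (κ : ℕ → ℕ)
    (x : ℕ → Fin 4) (g : Fin 4 → ℂ) (j : Fin 4) : ‖phaseProd w m κ x * g j‖ ≤ ‖g‖ := by
  rw [norm_mul, norm_phaseProd hw, one_mul]
  exact norm_le_pi_norm g j

/-- Backward recursion: conditioning on everything before the last step replaces `g` by its one-step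
image. With the switch counts frozen, the Markov property turns the last `κ m` switches into a power
of `turnOp`; averaging over `κ m` gives `poissonTurnOp`. -/
theorem integral_phaseProd_succ [IsProbabilityMeasure P] {ξ : ℕ → Ω → Fin 4} {p : ℝ}
    (hp0 : 0 ≤ p) (hp1 : p ≤ 1)
    (hξ : IsDirectionChain ξ p P) {κ : ℕ → Ω → ℕ} {r : ℝ≥0} (hκm : ∀ i, Measurable (κ i))
    (hκ : iIndepFun κ P) (hlaw : ∀ i, HasLaw (κ i) (poissonMeasure r) P)
    (hind : IndepFun (fun ω i => κ i ω) (fun ω n => ξ n ω) P)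
    {w : Fin 4 → ℂ} (hw : ∀ j, ‖w j‖ = 1) (m : ℕ) (g : Fin 4 → ℂ) :
    ∫ ω, phaseProd w (m + 1) (fun i => κ i ω) (fun n => ξ n ω) *
        g (ξ (switchCount (fun i => κ i ω) (m + 1)) ω) ∂P =
      ∫ ω, phaseProd w m (fun i => κ i ω) (fun n => ξ n ω) *
        (fun j => w j * poissonTurnOp p r g j)
          (ξ (switchCount (fun i => κ i ω) m) ω) ∂P := by
  have hK : Measurable fun ω i => κ i ω := measurable_pi_lambda _ hκm
  have hX : Measurable fun ω n => ξ n ω := measurable_pi_lambda _ hξ.measurable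
  have hiter : Measurable fun z : ℕ × Fin 4 => (turnOp p)^[z.1] g z.2 := Measurable.of_discrete
  -- decouple the switching times from the directions
  rw [integral_comp_indepFun hK hX hind
    (Φ := fun κ x => phaseProd w (m + 1) κ x * g (x (switchCount κ (m + 1)))) (C := ‖g‖)
    ((measurable_phaseProd w (m + 1)).mul
      ((Measurable.of_discrete (f := g)).comp (measurable_direction_switchCount (m + 1))))
    (fun κ x => norm_phaseProd_mul_le hw _ _ _ _ _)]
  -- the Markov property of the directions
  have step1 : ∀ k : ℕ → ℕ, ∫ ω, phaseProd w (m + 1) k (fun n => ξ n ω) *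
      g (ξ (switchCount k (m + 1)) ω) ∂P =
      ∫ ω, phaseProd w (m + 1) k (fun n => ξ n ω) *
        (turnOp p)^[k m] g (ξ (switchCount k m) ω) ∂P := by
    intro k
    have e : switchCount k (m + 1) = switchCount k m + k m := Finset.sum_range_succ _ _
    rw [e]
    refine integral_mul_later_direction hξ _ (phaseProd w (m + 1) k) (fun x y h => ?_) (k m) g
    refine Finset.prod_congr rfl fun i hi => ?_
    rw [h _ (switchCount_mono k (Nat.le_of_lt_succ (Finset.mem_range.1 hi)))]
  simp only [step1]
  have hmeas : Measurable fun z : (ℕ → ℕ) × (ℕ → Fin 4) =>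
      phaseProd w (m + 1) z.1 z.2 * (turnOp p)^[z.1 m] g (z.2 (switchCount z.1 m)) :=
    (measurable_phaseProd w (m + 1)).mul (hiter.comp
      (((measurable_pi_apply m).comp measurable_fst).prodMk (measurable_direction_switchCount m)))
  have hbd : ∀ (k : ℕ → ℕ) (x : ℕ → Fin 4) (l : ℕ) (j : Fin 4),
      ‖phaseProd w (m + 1) k x * (turnOp p)^[l] g j‖ ≤ ‖g‖ := fun k x l j =>
    (norm_phaseProd_mul_le hw _ _ _ _ _).trans (norm_iterate_turnOp_le hp0 hp1 g l)
  rw [integral_integral_swap (μ := P) (ν := P)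
    (f := fun ω ω' => phaseProd w (m + 1) (fun i => κ i ω) (fun n => ξ n ω') *
      (turnOp p)^[κ m ω] g (ξ (switchCount (fun i => κ i ω) m) ω'))
    (Integrable.of_bound (hmeas.comp
      ((hK.comp measurable_fst).prodMk (hX.comp measurable_snd))).aestronglyMeasurable ‖g‖
      (Filter.Eventually.of_forall fun z => hbd _ _ _ _))]
  -- the last increment is independent of the previous ones
  let trunc : (Finset.range m → ℕ) → ℕ → ℕ := fun a i =>
    if h : i ∈ Finset.range m then a ⟨i, h⟩ else 0
  have htrunc : Measurable trunc := by
    refine measurable_pi_lambda _ fun i => ?_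
    by_cases h : i ∈ Finset.range m
    · simpa only [trunc, dif_pos h] using measurable_pi_apply _
    · simpa only [trunc, dif_neg h] using measurable_const
  have hind' : IndepFun (fun ω => trunc fun i => κ i ω) (κ m) P := by
    have h := hκ.indepFun_finset (Finset.range m) {m} (by simp) hκm
    exact h.comp htrunc (measurable_pi_apply (⟨m, by simp⟩ : ({m} : Finset ℕ)))
  have hK' : Measurable fun ω => trunc fun i : Finset.range m => κ i ω :=
    htrunc.comp (measurable_pi_lambda _ fun i => hκm i)
  -- Phases are read at the start of each step, so all `m + 1` of them depend only on `κ 0, …, κ (m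
  -- - 1)` and are independent of `κ m`.
  have hcount : ∀ ω, ∀ k ≤ m, switchCount (fun i => κ i ω) k =
      switchCount (trunc fun i => κ i ω) k := by
    intro ω k hk
    refine Finset.sum_congr rfl fun i hi => ?_
    have : i ∈ Finset.range m := Finset.mem_range.2 ((Finset.mem_range.1 hi).trans_le hk)
    simp only [trunc, dif_pos this]
  have hphase : ∀ ω x, phaseProd w (m + 1) (fun i => κ i ω) x =
      phaseProd w (m + 1) (trunc fun i => κ i ω) x := fun ω x =>
    Finset.prod_congr rfl fun i hi => by
      rw [hcount ω i (Nat.le_of_lt_succ (Finset.mem_range.1 hi))]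
  have step2 : ∀ x : ℕ → Fin 4, ∫ ω, phaseProd w (m + 1) (fun i => κ i ω) x *
      (turnOp p)^[κ m ω] g (x (switchCount (fun i => κ i ω) m)) ∂P =
      ∫ ω, phaseProd w m (fun i => κ i ω) x * (fun j => w j * poissonTurnOp p r g j)
          (x (switchCount (fun i => κ i ω) m)) ∂P := by
    intro x
    simp only [hphase, hcount _ m le_rfl]
    rw [integral_comp_indepFun hK' (hκm m) hind'
      (Φ := fun k l => phaseProd w (m + 1) k x * (turnOp p)^[l] g (x (switchCount k m)))
      (C := ‖g‖) ?_ (fun k l => hbd k x l _)]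
    · refine integral_congr_ae (Filter.Eventually.of_forall fun ω => ?_)
      have e : phaseProd w m (fun i => κ i ω) x = phaseProd w m (trunc fun i => κ i ω) x :=
        Finset.prod_congr rfl fun i hi => by rw [hcount ω i (Finset.mem_range.1 hi).le]
      simp only [integral_const_mul, e]
      rw [phaseProd, Finset.prod_range_succ, ← phaseProd, mul_assoc]
      congr 2
      rw [poissonTurnOp, ← (hlaw m).map_eq, integral_map (hκm m).aemeasurable
        StronglyMeasurable.of_discrete.aestronglyMeasurable]
    · have hx : Measurable fun k : ℕ → ℕ => (k, x) := measurable_id.prodMk measurable_const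
      exact (((measurable_phaseProd w (m + 1)).comp hx).comp measurable_fst).mul
        (hiter.comp (measurable_snd.prodMk
          (((measurable_direction_switchCount m).comp hx).comp measurable_fst)))
  simp only [step2]
  -- couple again
  have hmeas' : Measurable fun z : (ℕ → ℕ) × (ℕ → Fin 4) =>
      phaseProd w m z.1 z.2 * (fun j => w j * poissonTurnOp p r g j)
        (z.2 (switchCount z.1 m)) :=
    (measurable_phaseProd w m).mul
      ((Measurable.of_discrete (f := fun j => w j * poissonTurnOp p r g j)).comp
        (measurable_direction_switchCount m))
  have hbd' : ∀ (k : ℕ → ℕ) (x : ℕ → Fin 4), ‖phaseProd w m k x *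
      (fun j => w j * poissonTurnOp p r g j) (x (switchCount k m))‖ ≤
        ‖fun j => w j * poissonTurnOp p r g j‖ := fun k x =>
    norm_phaseProd_mul_le hw _ _ _ (fun j => w j * poissonTurnOp p r g j) _
  rw [integral_integral_swap (μ := P) (ν := P)
    (f := fun ω' ω => phaseProd w m (fun i => κ i ω) (fun n => ξ n ω') *
      (fun j => w j * poissonTurnOp p r g j) (ξ (switchCount (fun i => κ i ω) m) ω'))
    (Integrable.of_bound (hmeas'.comp
      ((hK.comp measurable_snd).prodMk (hX.comp measurable_fst))).aestronglyMeasurable _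
      (Filter.Eventually.of_forall fun z => hbd' _ _))]
  exact (integral_comp_indepFun hK hX hind hmeas' hbd').symm

theorem integral_phaseProd [IsProbabilityMeasure P] {ξ : ℕ → Ω → Fin 4} {p : ℝ}
    (hp0 : 0 ≤ p) (hp1 : p ≤ 1)
    (hξ : IsDirectionChain ξ p P) {κ : ℕ → Ω → ℕ} {r : ℝ≥0} (hκm : ∀ i, Measurable (κ i))
    (hκ : iIndepFun κ P) (hlaw : ∀ i, HasLaw (κ i) (poissonMeasure r) P)
    (hind : IndepFun (fun ω i => κ i ω) (fun ω n => ξ n ω) P)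
    {w : Fin 4 → ℂ} (hw : ∀ j, ‖w j‖ = 1) (m : ℕ) (g : Fin 4 → ℂ) :
    ∫ ω, phaseProd w m (fun i => κ i ω) (fun n => ξ n ω) *
        g (ξ (switchCount (fun i => κ i ω) m) ω) ∂P =
      1 / 4 * ∑ j, (fun (f : Fin 4 → ℂ) j => w j * poissonTurnOp p r f j)^[m] g j := by
  induction m generalizing g with
  | zero => simpa [phaseProd, switchCount] using integral_initialDirection hξ g
  | succ m ih =>
    rw [Function.iterate_succ_apply]
    exact (integral_phaseProd_succ hp0 hp1 hξ hκm hκ hlaw hind hw m g).trans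
      (ih fun j => w j * poissonTurnOp p r g j)

/-! ### Riemann sums along paths -/

theorem intervalIntegrable_of_bound {f : ℝ → ℝ} (hf : Measurable f) {C : ℝ} (hC : ∀ s, ‖f s‖ ≤ C)
    (a b : ℝ) : IntervalIntegrable f volume a b :=
  ⟨Integrable.of_bound hf.aestronglyMeasurable C (Filter.Eventually.of_forall hC),
    Integrable.of_bound hf.aestronglyMeasurable C (Filter.Eventually.of_forall hC)⟩

/-- Convergence of left Riemann sums of a bounded, almost everywhere continuous function. -/
theorem tendsto_leftRiemannSum {f : ℝ → ℝ} (hf : Measurable f) {C : ℝ} (hC : ∀ s, ‖f s‖ ≤ C)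
    (hcont : ∀ᵐ s, ContinuousAt f s) {t : ℝ} (ht : 0 < t) :
    Filter.Tendsto (fun m : ℕ => ∑ k ∈ Finset.range m, t / m * f (k * (t / m))) Filter.atTop
      (nhds (∫ s in (0 : ℝ)..t, f s)) := by
  -- The Riemann sum is the integral of the step function that evaluates `f` at the grid point to
  -- the left of `s`; dominated convergence then applies.
  have hstep : ∀ h : ℝ, Measurable fun s : ℝ => f (⌊s / h⌋₊ * h) := fun h =>
    hf.comp ((measurable_from_nat (f := fun n : ℕ => (n : ℝ) * h)).comp
      (Nat.measurable_floor.comp (measurable_id.div_const h)))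
  have hint : ∀ h a b : ℝ, IntervalIntegrable (fun s : ℝ => f (⌊s / h⌋₊ * h)) volume a b :=
    fun h => intervalIntegrable_of_bound (hstep h) fun s => hC _
  have hsum : ∀ m : ℕ, 0 < m → ∑ k ∈ Finset.range m, t / m * f (k * (t / m)) =
      ∫ s in (0 : ℝ)..t, f (⌊s / (t / m)⌋₊ * (t / m)) := by
    intro m hm
    have hm' : (0 : ℝ) < m := by exact_mod_cast hm
    set h := t / m with hh
    have hpos : 0 < h := by positivity
    have hend : (m : ℝ) * h = t := by rw [hh]; field_simp
    have := intervalIntegral.sum_integral_adjacent_intervals (μ := volume)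
      (f := fun s : ℝ => f (⌊s / h⌋₊ * h)) (a := fun k : ℕ => (k : ℝ) * h) (n := m)
      fun k _ => hint h _ _
    simp only [Nat.cast_zero, zero_mul, hend] at this
    rw [← this]
    refine Finset.sum_congr rfl fun k _ => ?_
    have hle : (k : ℝ) * h ≤ ((k + 1 : ℕ) : ℝ) * h := by push_cast; nlinarith
    rw [intervalIntegral.integral_congr_Ioo_of_le (g := fun _ => f (k * h)) hle]
    · rw [intervalIntegral.integral_const, smul_eq_mul]
      push_cast
      ring
    · intro s hs
      have : ⌊s / h⌋₊ = k := by
        have hs1 := hs.1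
        have hs2 := hs.2
        push_cast at hs2
        have h0 : 0 ≤ s / h := div_nonneg ((by positivity : 0 ≤ (k : ℝ) * h).trans hs1.le) hpos.le
        rw [Nat.floor_eq_iff h0]
        exact ⟨(le_div_iff₀ hpos).2 hs1.le, (div_lt_iff₀ hpos).2 hs2⟩
      simp only [this]
  have hlim : Filter.Tendsto (fun m : ℕ => ∫ s in (0 : ℝ)..t, f (⌊s / (t / m)⌋₊ * (t / m)))
      Filter.atTop (nhds (∫ s in (0 : ℝ)..t, f s)) := by
    refine intervalIntegral.tendsto_integral_filter_of_dominated_convergence (fun _ => C)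
      (Filter.Eventually.of_forall fun m => (hstep _).aestronglyMeasurable)
      (Filter.Eventually.of_forall fun m => Filter.Eventually.of_forall fun s _ => hC _)
      (by simp) ?_
    filter_upwards [hcont] with s hs hmem
    rw [Set.uIoc_of_le ht.le] at hmem
    refine hs.tendsto.comp ?_
    rw [tendsto_iff_norm_sub_tendsto_zero]
    refine squeeze_zero' (g := fun m : ℕ => t * (1 / (m : ℝ)))
      (Filter.Eventually.of_forall fun _ => norm_nonneg _) ?_
      (by simpa using tendsto_one_div_atTop_nhds_zero_nat.const_mul t)
    filter_upwards [Filter.eventually_gt_atTop 0] with m hm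
    have hm' : (0 : ℝ) < m := by exact_mod_cast hm
    have hpos : 0 < t / m := by positivity
    have h1 := Nat.floor_le (div_nonneg hmem.1.le hpos.le)
    have h2 := Nat.lt_floor_add_one (s / (t / m))
    rw [le_div_iff₀ hpos] at h1
    rw [div_lt_iff₀ hpos] at h2
    rw [Real.norm_eq_abs, abs_of_nonpos (by linarith)]
    have : t * (1 / (m : ℝ)) = t / m := by ring
    linarith
  refine hlim.congr' ?_
  filter_upwards [Filter.eventually_gt_atTop 0] with m hm
  exact (hsum m hm).symm

/-- A monotone path has countably many jumps, so the integrand is continuous almost everywhere. -/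
theorem tendsto_leftRiemannSum_path {n : ℝ≥0 → ℕ} (hn : Monotone n) (ψ : ℕ → ℝ) {C : ℝ}
    (hC : ∀ k, ‖ψ k‖ ≤ C) {t : ℝ} (ht : 0 < t) :
    Filter.Tendsto (fun m : ℕ => ∑ k ∈ Finset.range m, t / m * ψ (n (k * (t / m)).toNNReal))
      Filter.atTop (nhds (∫ s in (0 : ℝ)..t, ψ (n s.toNNReal))) := by
  have hmono : Monotone fun s : ℝ => n s.toNNReal := hn.comp fun _ _ h => Real.toNNReal_mono h
  refine tendsto_leftRiemannSum (f := fun s => ψ (n s.toNNReal))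
    (Measurable.of_discrete.comp hmono.measurable) (fun s => hC _) ?_ ht
  have hae : ∀ᵐ s : ℝ, s ∉ {s : ℝ | ¬ ContinuousAt (fun s : ℝ => n s.toNNReal) s} :=
    measure_eq_zero_iff_ae_notMem.1 (hmono.countable_not_continuousAt.measure_zero volume)
  filter_upwards [hae] with s hs
  have hs' : ContinuousAt (fun s : ℝ => n s.toNNReal) s := by simpa using hs
  exact (continuous_of_discreteTopology (f := ψ)).continuousAt.comp hs'

/-! ### From the discretised motion to the particle -/

variable {lam p : ℝ} {N : ℝ≥0 → Ω → ℕ} {ξ : ℕ → Ω → Fin 4}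

theorem intervalIntegrable_direction {n : ℝ≥0 → ℕ} (hn : Monotone n) (b : Fin 4 → ℝ)
    (x : ℕ → Fin 4) (t : ℝ) :
    IntervalIntegrable (fun s : ℝ => b (x (n s.toNNReal))) volume 0 t := by
  have hmono : Monotone fun s : ℝ => n s.toNNReal := hn.comp fun _ _ h => Real.toNNReal_mono h
  exact intervalIntegrable_of_bound
    ((Measurable.of_discrete (f := fun k => b (x k))).comp hmono.measurable)
    (fun s => norm_le_pi_norm b _) 0 t

theorem measurable_direction (h : IsDirectionMechanism N ξ lam p P) (s : ℝ≥0) :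
    Measurable (direction N ξ s) :=
  measurable_apply_index.comp ((h.poisson.measurable s).prodMk
    (measurable_pi_lambda _ h.chain.measurable))

/-- The integral is a limit of measurable Riemann sums, but only along monotone paths, hence almost
surely. -/
theorem aemeasurable_integral_direction (h : IsDirectionMechanism N ξ lam p P) (b : Fin 4 → ℝ)
    {t : ℝ} (ht : 0 < t) :
    AEMeasurable (fun ω => ∫ s in (0 : ℝ)..t, b (direction N ξ s.toNNReal ω)) P := by
  refine aemeasurable_of_tendsto_metrizable_ae Filter.atTop
    (f := fun m ω => ∑ k ∈ Finset.range m, t / m * b (direction N ξ (k * (t / m)).toNNReal ω))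
    (fun m => ?_) ?_
  · exact (Finset.measurable_sum _ fun k _ => measurable_const.mul
      ((Measurable.of_discrete (f := b)).comp (measurable_direction h _))).aemeasurable
  · filter_upwards [h.poisson.monotone] with ω hω
    exact tendsto_leftRiemannSum_path hω (fun k => b (ξ k ω)) (fun k => norm_le_pi_norm b _) ht

theorem integral_exp_leftRiemannSum [IsProbabilityMeasure P] (hp0 : 0 ≤ p)
    (hp1 : p ≤ 1) (hmech : IsDirectionMechanism N ξ lam p P) (b : Fin 4 → ℝ) (h : ℝ)
    (m : ℕ) :
    ∫ ω, Complex.exp (Complex.I * (∑ k ∈ Finset.range m,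
        h * b (direction N ξ (k * h).toNNReal ω) : ℝ)) ∂P =
      1 / 4 * ∑ j, (stepOp lam p b h)^[m] (fun _ => 1) j := by
  let r : ℝ≥0 := h.toNNReal
  let κ : ℕ → Ω → ℕ := fun i ω => N ((i + 1 : ℕ) * r) ω - N (i * r) ω
  have hgrid : Monotone fun i : ℕ => (i : ℝ≥0) * r := fun i j hij => by
    show (i : ℝ≥0) * r ≤ j * r
    gcongr
  have hκm : ∀ i, Measurable (κ i) := fun i =>
    (hmech.poisson.measurable _).sub (hmech.poisson.measurable _)
  have hκ : iIndepFun κ P := hmech.poisson.indepIncrements.nat hgrid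
  have hlaw : ∀ i, HasLaw (κ i) (poissonMeasure (lam.toNNReal * h.toNNReal)) P := by
    intro i
    have := hmech.poisson.law_increment (i * r) ((i + 1 : ℕ) * r) (hgrid (Nat.le_succ i))
    have e : ((i + 1 : ℕ) : ℝ≥0) * r - i * r = r := by
      push_cast; rw [add_mul, one_mul, add_tsub_cancel_left]
    rwa [e] at this
  have hind : IndepFun (fun ω i => κ i ω) (fun ω n => ξ n ω) P :=
    hmech.indep.comp (φ := fun (f : ℝ≥0 → ℕ) (i : ℕ) => f ((i + 1 : ℕ) * r) - f (i * r))
      (measurable_pi_lambda _ fun i => (measurable_pi_apply _).sub (measurable_pi_apply _))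
      measurable_id
  have main := integral_phaseProd hp0 hp1 hmech.chain hκm hκ hlaw hind
    (w := fun j => Complex.exp (Complex.I * (h * b j : ℝ))) (fun j => norm_exp_I_mul_ofReal_eq_one _) m
    (fun _ => 1)
  refine Eq.trans ?_ main
  refine integral_congr_ae ?_
  filter_upwards [hmech.poisson.monotone, hmech.poisson.zero] with ω hmono hzero
  -- The increments telescope, with no loss from truncated subtraction since the path is monotone
  -- and starts at `0`.
  have hcount : ∀ k, switchCount (fun i => κ i ω) k = N (k * h).toNNReal ω := by
    intro k
    have := Finset.sum_range_tsub (f := fun i : ℕ => N (i * r) ω) (hmono.comp hgrid) k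
    rw [switchCount, this]
    simp [hzero, r, Real.toNNReal_mul]
  simp only [mul_one, phaseProd, hcount, direction]
  rw [← Complex.exp_sum, Complex.ofReal_sum, Finset.mul_sum]

theorem integral_exp_integral_direction [IsProbabilityMeasure P] (hlam : 0 ≤ lam) (hp0 : 0 ≤ p)
    (hp1 : p ≤ 1) (hmech : IsDirectionMechanism N ξ lam p P) {c t : ℝ} (hc : 0 < c) (ht : 0 < t)
    (α β : ℝ) :
    ∫ ω, Complex.exp (Complex.I * (∫ s in (0 : ℝ)..t,
        (fun j => c * (α * signU j + β * signV j)) (direction N ξ s.toNNReal ω) : ℝ)) ∂P =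
      charFun (telegraphLaw (lam * (1 - p)) c t) α * charFun (telegraphLaw (lam * p) c t) β := by
  set b : Fin 4 → ℝ := fun j => c * (α * signU j + β * signV j) with hb
  have h1 : Filter.Tendsto (fun m : ℕ => ∫ ω, Complex.exp (Complex.I * (∑ k ∈ Finset.range m,
      t / m * b (direction N ξ (k * (t / m)).toNNReal ω) : ℝ)) ∂P) Filter.atTop
      (nhds (∫ ω, Complex.exp (Complex.I * (∫ s in (0 : ℝ)..t,
        b (direction N ξ s.toNNReal ω) : ℝ)) ∂P)) := by
    refine tendsto_integral_of_dominated_convergence (fun _ => 1) (fun m => ?_)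
      (integrable_const 1)
      (fun m => Filter.Eventually.of_forall fun ω => (norm_exp_I_mul_ofReal_eq_one _).le) ?_
    · have : Measurable fun ω => ∑ k ∈ Finset.range m,
          t / m * b (direction N ξ (k * (t / m)).toNNReal ω) :=
        Finset.measurable_sum _ fun k _ => measurable_const.mul
          ((Measurable.of_discrete (f := b)).comp (measurable_direction hmech _))
      exact (by fun_prop : Measurable fun ω => Complex.exp (Complex.I * (∑ k ∈ Finset.range m,
          t / m * b (direction N ξ (k * (t / m)).toNNReal ω) : ℝ))).aestronglyMeasurable
    · filter_upwards [hmech.poisson.monotone] with ω hω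
      have := tendsto_leftRiemannSum_path hω (fun k => b (ξ k ω)) (fun k => norm_le_pi_norm b _) ht
      exact ((by fun_prop : Continuous fun x : ℝ => Complex.exp (Complex.I * (x : ℂ))).tendsto
        _).comp this
  have h2 : Filter.Tendsto (fun m : ℕ => 1 / 4 * ∑ j, (stepOp lam p b (t / m))^[m] (fun _ => 1) j)
      Filter.atTop (nhds (1 / 4 * ∑ j, motionChar lam p c α β t j)) :=
    (tendsto_finsetSum _ fun j _ =>
      tendsto_pi_nhds.1 (tendsto_iterate_stepOp hlam hp0 hp1 c α β ht.le) j).const_mul _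
  have h3 := tendsto_nhds_unique h1 (h2.congr fun m =>
    (integral_exp_leftRiemannSum hp0 hp1 hmech b _ m).symm)
  rw [h3, sum_motionChar hlam hp0 hp1 hc ht.le]
  ring

/-! ### The law in rotated coordinates -/

/-- The coordinates `(x + y, x - y)`. -/
noncomputable def rotation : ℝ × ℝ →L[ℝ] ℝ × ℝ :=
  (Matrix.toLin (Module.Basis.finTwoProd ℝ) (Module.Basis.finTwoProd ℝ)
    !![1, 1; 1, -1]).toContinuousLinearMap

theorem rotation_apply (z : ℝ × ℝ) : rotation z = (z.1 + z.2, z.1 - z.2) := by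
  rw [rotation, Matrix.toLin_finTwoProd_toContinuousLinearMap]
  simp [sub_eq_add_neg]

theorem det_rotation : rotation.det = -2 := by
  rw [rotation, LinearMap.det_toContinuousLinearMap, LinearMap.det_toLin, Matrix.det_fin_two_of]
  norm_num

theorem injective_rotation : Function.Injective rotation := by
  intro z w h
  simp only [rotation_apply, Prod.mk.injEq] at h
  ext <;> linarith [h.1, h.2]

theorem aemeasurable_position (hmech : IsDirectionMechanism N ξ lam p P) (c : ℝ) {t : ℝ}
    (ht : 0 < t) : AEMeasurable (position N ξ c t) P :=
  (aemeasurable_integral_direction hmech (fun j => c * (dirVec j).1) ht).prodMk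
    (aemeasurable_integral_direction hmech (fun j => c * (dirVec j).2) ht)

/-- In the rotated coordinates the position has independent telegraph distributed components. -/
theorem map_rotation_position [IsProbabilityMeasure P] (hlam : 0 ≤ lam) (hp0 : 0 ≤ p)
    (hp1 : p ≤ 1) (hmech : IsDirectionMechanism N ξ lam p P) {c t : ℝ} (hc : 0 < c) (ht : 0 < t) :
    (P.map (position N ξ c t)).map rotation =
      (telegraphLaw (lam * (1 - p)) c t).prod (telegraphLaw (lam * p) c t) := by
  have hpos := aemeasurable_position hmech c ht
  have hdual : ∀ (μ : Measure ℝ) (L : StrongDual ℝ ℝ), charFunDual μ L = charFun μ (L 1) := by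
    intro μ L
    rw [charFunDual_apply, charFun_apply_real]
    congr 1
    ext x
    have : L x = L 1 * x := by
      rw [mul_comm, ← smul_eq_mul, ← map_smul, smul_eq_mul, mul_one]
    rw [this]
    push_cast
    rfl
  have hfin : IsFiniteMeasure (P.map (position N ξ c t)) := inferInstance
  refine Measure.ext_of_charFunDual ?_
  ext L
  rw [charFunDual_prod, hdual, hdual, charFunDual_map, charFunDual_apply,
    integral_map hpos (Measurable.aestronglyMeasurable (by fun_prop))]
  rw [← integral_exp_integral_direction hlam hp0 hp1 hmech hc ht]
  refine integral_congr_ae ?_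
  filter_upwards [hmech.poisson.monotone] with ω hω
  have i1 : IntervalIntegrable (fun s : ℝ => c * (dirVec (direction N ξ s.toNNReal ω)).1)
      volume 0 t := intervalIntegrable_direction hω (fun j => c * (dirVec j).1) (fun k => ξ k ω) t
  have i2 : IntervalIntegrable (fun s : ℝ => c * (dirVec (direction N ξ s.toNNReal ω)).2)
      volume 0 t := intervalIntegrable_direction hω (fun j => c * (dirVec j).2) (fun k => ξ k ω) t
  have hL : ∀ z : ℝ × ℝ, L z = L (1, 0) * z.1 + L (0, 1) * z.2 := by
    intro z
    have : z = z.1 • ((1, 0) : ℝ × ℝ) + z.2 • ((0, 1) : ℝ × ℝ) := by ext <;> simp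
    conv_lhs => rw [this]
    rw [map_add, map_smul, map_smul, smul_eq_mul, smul_eq_mul, mul_comm, mul_comm z.2]
  -- A linear functional of the rotated position has frequencies `α = L (1, 0)` and `β = L (0, 1)`
  -- in the transform already computed.
  have hval : L (rotation (position N ξ c t ω)) = ∫ s in (0 : ℝ)..t,
      c * (L (1, 0) * signU (direction N ξ s.toNNReal ω) +
        L (0, 1) * signV (direction N ξ s.toNNReal ω)) := by
    have e : ∀ s : ℝ, c * (L (1, 0) * signU (direction N ξ s.toNNReal ω) +
        L (0, 1) * signV (direction N ξ s.toNNReal ω)) =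
        (L (1, 0) + L (0, 1)) * (c * (dirVec (direction N ξ s.toNNReal ω)).1) +
        (L (1, 0) - L (0, 1)) * (c * (dirVec (direction N ξ s.toNNReal ω)).2) := by
      intro s
      rw [← dirVec_fst_add_snd, ← dirVec_fst_sub_snd]
      ring
    simp only [e]
    rw [intervalIntegral.integral_add (i1.const_mul _) (i2.const_mul _),
      intervalIntegral.integral_const_mul (L (1, 0) + L (0, 1)),
      intervalIntegral.integral_const_mul (L (1, 0) - L (0, 1)), hL,
      rotation_apply]
    simp only [position]
    ring
  simp only [ContinuousLinearMap.comp_apply, ContinuousLinearMap.inl_apply,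
    ContinuousLinearMap.inr_apply, hval]
  rw [mul_comm]

/-! ### The density inside the square -/

theorem telegraphLaw_restrict_Ioo (μ c t : ℝ) :
    (telegraphLaw μ c t).restrict (Set.Ioo (-(c * t)) (c * t)) =
      (volume.restrict (Set.Ioo (-(c * t)) (c * t))).withDensity
        fun u => ENNReal.ofReal (telegraphDensity μ c t u) := by
  classical
  have hI : MeasurableSet (Set.Ioo (-(c * t)) (c * t)) := measurableSet_Ioo
  rw [telegraphLaw, Measure.restrict_add, Measure.restrict_smul, Measure.restrict_add,
    restrict_dirac' hI, restrict_dirac' hI, if_neg (fun h => lt_irrefl _ h.2), if_neg (fun h => lt_irrefl _ h.1),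
    restrict_withDensity hI, Measure.restrict_restrict hI, Set.inter_self]
  simp

theorem prod_telegraphLaw_apply {μ ν c t : ℝ} {B : Set (ℝ × ℝ)} (hB : MeasurableSet B)
    (hBI : B ⊆ Set.Ioo (-(c * t)) (c * t) ×ˢ Set.Ioo (-(c * t)) (c * t)) :
    ((telegraphLaw μ c t).prod (telegraphLaw ν c t)) B =
      ∫⁻ z in B, ENNReal.ofReal (telegraphDensity μ c t z.1) *
        ENNReal.ofReal (telegraphDensity ν c t z.2) := by
  have h1 := (continuous_telegraphDensity μ c t).measurable.ennreal_ofReal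
  have h2 := (continuous_telegraphDensity ν c t).measurable.ennreal_ofReal
  rw [← Measure.restrict_eq_self _ hBI, ← Measure.prod_restrict, telegraphLaw_restrict_Ioo,
    telegraphLaw_restrict_Ioo, prod_withDensity h1 h2, withDensity_apply _ hB,
    Measure.prod_restrict, Measure.restrict_restrict hB, Set.inter_eq_left.2 hBI]
  rfl

theorem abs_add_lt_and_abs_sub_lt {x y a : ℝ} (h : |x| + |y| < a) : |x + y| < a ∧ |x - y| < a :=
  ⟨(abs_add_le x y).trans_lt h, (abs_sub x y).trans_lt h⟩

theorem sq_sub_sq_pos_of_abs_lt {c t w : ℝ} (h : |w| < c * t) : 0 < c ^ 2 * t ^ 2 - w ^ 2 := by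
  rw [← mul_pow, sub_pos, ← sq_abs w]
  gcongr

/-- The factor `exp (-λ t)` splits because the two rates add up to `λ`. The `2` is the Jacobian of
the rotation, which turns `1 / (2 c) ^ 2` into `1 / (2 c ^ 2)`. -/
theorem interiorDensity_eq {lam p c x y t : ℝ} (hc : 0 < c) (h : |x| + |y| < c * t) :
    interiorDensity lam p c x y t =
      2 * (telegraphDensity (lam * (1 - p)) c t (x + y) * telegraphDensity (lam * p) c t (x - y)) := by
  obtain ⟨h1, h2⟩ := abs_add_lt_and_abs_sub_lt h
  have p1 := sq_sub_sq_pos_of_abs_lt h1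
  have p2 := sq_sub_sq_pos_of_abs_lt h2
  have e : Real.exp (-(lam * t)) =
      Real.exp (-(lam * (1 - p) * t)) * Real.exp (-(lam * p * t)) := by
    rw [← Real.exp_add]; ring_nf
  unfold interiorDensity telegraphDensity
  rw [(hasDerivAt_besselI0_sqrt (lam * (1 - p) / c) c (x + y) t p1).deriv,
    (hasDerivAt_besselI0_sqrt (lam * p / c) c (x - y) t p2).deriv,
    besselI0_mul_sqrt _ p1.le, besselI0_mul_sqrt _ p2.le, e, mul_pow c t]
  field_simp

theorem measurableSet_openSquare (c t : ℝ) : MeasurableSet (openSquare c t) :=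
  measurableSet_lt (by fun_prop) measurable_const

theorem interiorDensity_nonneg {c x y t : ℝ} (hlam : 0 ≤ lam) (hp0 : 0 ≤ p) (hp1 : p ≤ 1)
    (hc : 0 < c) (ht : 0 ≤ t) (h : |x| + |y| < c * t) : 0 ≤ interiorDensity lam p c x y t := by
  obtain ⟨h1, h2⟩ := abs_add_lt_and_abs_sub_lt h
  rw [interiorDensity_eq hc h]
  have := telegraphDensity_nonneg (mul_nonneg hlam (sub_nonneg.2 hp1)) hc ht h1.le
  have := telegraphDensity_nonneg (mul_nonneg hlam hp0) hc ht h2.le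
  positivity

theorem map_position_apply [IsProbabilityMeasure P] (hlam : 0 ≤ lam) (hp0 : 0 ≤ p)
    (hp1 : p ≤ 1) (hmech : IsDirectionMechanism N ξ lam p P) {c t : ℝ} (hc : 0 < c) (ht : 0 < t)
    {A : Set (ℝ × ℝ)} (hA : MeasurableSet A) (hAs : A ⊆ openSquare c t) :
    P.map (position N ξ c t) A =
      ∫⁻ z in A, ENNReal.ofReal (interiorDensity lam p c z.1 z.2 t) := by
  -- An injective continuous image of a Borel set is Borel.
  have hrA : MeasurableSet (rotation '' A) :=
    hA.image_of_continuousOn_injOn rotation.continuous.continuousOn injective_rotation.injOn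
  have hsub : rotation '' A ⊆ Set.Ioo (-(c * t)) (c * t) ×ˢ Set.Ioo (-(c * t)) (c * t) := by
    rintro _ ⟨z, hz, rfl⟩
    obtain ⟨h1, h2⟩ := abs_add_lt_and_abs_sub_lt (hAs hz)
    rw [rotation_apply]
    exact ⟨abs_lt.1 h1, abs_lt.1 h2⟩
  have h := prod_telegraphLaw_apply (μ := lam * (1 - p)) (ν := lam * p) hrA hsub
  rw [← map_rotation_position hlam hp0 hp1 hmech hc ht,
    Measure.map_apply rotation.continuous.measurable hrA,
    injective_rotation.preimage_image,
    -- Change of variables back to `(x, y)`, with constant Jacobian `|-2|`.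
    lintegral_image_eq_lintegral_abs_det_fderiv_mul volume hA
      (fun z _ => rotation.hasFDerivWithinAt) injective_rotation.injOn] at h
  rw [h]
  refine setLIntegral_congr_fun hA fun z hz => ?_
  obtain ⟨h1, h2⟩ := abs_add_lt_and_abs_sub_lt (hAs hz)
  have d1 := telegraphDensity_nonneg (mul_nonneg hlam (sub_nonneg.2 hp1)) hc ht.le h1.le
  simp only [det_rotation, rotation_apply]
  rw [interiorDensity_eq hc (hAs hz), ← ENNReal.ofReal_mul d1, ← ENNReal.ofReal_mul (abs_nonneg _),
    abs_neg, abs_two]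

theorem aestronglyMeasurable_interiorDensity {c : ℝ} (hc : 0 < c) (t : ℝ) {A : Set (ℝ × ℝ)}
    (hA : MeasurableSet A) (hAs : A ⊆ openSquare c t) :
    AEStronglyMeasurable (fun z : ℝ × ℝ => interiorDensity lam p c z.1 z.2 t)
      (volume.restrict A) := by
  have hcont : Continuous fun z : ℝ × ℝ => 2 * (telegraphDensity (lam * (1 - p)) c t (z.1 + z.2) *
      telegraphDensity (lam * p) c t (z.1 - z.2)) := by
    have h1 := continuous_telegraphDensity (lam * (1 - p)) c t
    have h2 := continuous_telegraphDensity (lam * p) c t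
    fun_prop
  refine hcont.aestronglyMeasurable.congr ?_
  filter_upwards [ae_restrict_mem hA] with z hz
  exact (interiorDensity_eq hc (hAs hz)).symm

end PlanarMotion

theorem theorem3 {Ω : Type*} [MeasurableSpace Ω] (P : Measure Ω) [IsProbabilityMeasure P]
    (lam p c : ℝ) (hlam : 0 < lam) (hp0 : 0 < p) (hp1 : p < 1) (hc : 0 < c)
    (N : ℝ≥0 → Ω → ℕ) (ξ : ℕ → Ω → Fin 4)
    (hmotion : PlanarMotion.IsDirectionMechanism N ξ lam p P)
    (t : ℝ) (ht : 0 < t) :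
    -- the time derivatives in the formula exist
    (∀ x y : ℝ, |x| + |y| < c * t →
      DifferentiableAt ℝ (fun s : ℝ => PlanarMotion.besselI0
        (lam * (1 - p) / c * Real.sqrt (c ^ 2 * s ^ 2 - (x + y) ^ 2))) t ∧
      DifferentiableAt ℝ (fun s : ℝ => PlanarMotion.besselI0
        (lam * p / c * Real.sqrt (c ^ 2 * s ^ 2 - (x - y) ^ 2))) t) ∧
    AEMeasurable (PlanarMotion.position N ξ c t) P ∧
    IntegrableOn (fun z : ℝ × ℝ => PlanarMotion.interiorDensity lam p c z.1 z.2 t)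
      (PlanarMotion.openSquare c t) volume ∧
    ∀ A : Set (ℝ × ℝ), MeasurableSet A → A ⊆ PlanarMotion.openSquare c t →
      (P.map (PlanarMotion.position N ξ c t)).real A =
        ∫ z in A, PlanarMotion.interiorDensity lam p c z.1 z.2 t := by
  open PlanarMotion in
  have hpos := aemeasurable_position hmotion c ht
  have hprob : IsProbabilityMeasure (P.map (position N ξ c t)) :=
    Measure.isProbabilityMeasure_map hpos
  have hnonneg : ∀ A : Set (ℝ × ℝ), MeasurableSet A → A ⊆ openSquare c t →
      0 ≤ᵐ[volume.restrict A] fun z : ℝ × ℝ => interiorDensity lam p c z.1 z.2 t := by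
    intro A hA hAs
    filter_upwards [ae_restrict_mem hA] with z hz
    exact interiorDensity_nonneg hlam.le hp0.le hp1.le hc ht.le (hAs hz)
  refine ⟨fun x y h => ?_, hpos, ?_, fun A hA hAs => ?_⟩
  · obtain ⟨h1, h2⟩ := abs_add_lt_and_abs_sub_lt h
    exact ⟨(hasDerivAt_besselI0_sqrt _ c _ t (sq_sub_sq_pos_of_abs_lt h1)).differentiableAt,
      (hasDerivAt_besselI0_sqrt _ c _ t (sq_sub_sq_pos_of_abs_lt h2)).differentiableAt⟩
  · have hS := measurableSet_openSquare c t
    refine ⟨aestronglyMeasurable_interiorDensity hc t hS subset_rfl, ?_⟩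
    rw [hasFiniteIntegral_iff_ofReal (hnonneg _ hS subset_rfl),
      ← map_position_apply hlam.le hp0.le hp1.le hmotion hc ht hS subset_rfl]
    exact measure_lt_top _ _
  · rw [integral_eq_lintegral_of_nonneg_ae (hnonneg A hA hAs)
      (aestronglyMeasurable_interiorDensity hc t hA hAs),
      ← map_position_apply hlam.le hp0.le hp1.le hmotion hc ht hA hAs]
    rfl
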